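/- Let $n\ge 1$ and $\lambda\ge 1$ be integers, let $0<q<1$ and $t>0$ be real, write $(a)_m=\prod_{0\le k\le m-1}(1-aq^k)$, and assume $(t)_\lambda\neq 0$. Let $W$ be the Weyl group of type $C_n$ (signed permutations of the coordinates of $\mathbb Z^n$), and for $\nu\in\mathbb Z^n$ put $m_\nu=\sum_{\kappa\in W\nu}y_1^{\kappa_1}\cdots y_n^{\kappa_n}$. For $\mu,\nu\in\mathbb Z^n$ write $\nu<\mu$ if $\nu\ne\mu$ and $\mu-\nu$ is a nonnegative integral combination of the positive roots $\epsilon_i\pm\epsilon_j$ ($i<j$), $2\epsilon_i$. Let $$E=\sum_{a_1,\dots,a_n=\pm1}\ \prod_{1\le i<j\le n}\frac{1-ty_i^{a_i}y_j^{a_j}}{1-y_i^{a_i}y_j^{a_j}}\ \prod_{1\le i\le n}\frac{1-ty_i^{2a_i}}{1-y_i^{2a_i}}\,T_{y_i}^{a_i/2},\qquad (T_{y_i}^{\pm 1/2}f)(y)=f(y_1,\dots,q^{\pm 1/2}y_i,\dots,y_n),$$ be Macdonald's $q$-difference operator of type $C_n$ with $t_1=t_2=t$, and for a partition $\mu=(\mu_1\ge\dots\ge\mu_n\ge0)$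 let $$c_\mu=q^{-\frac12(\mu_1+\cdots+\mu_n)}\prod_{j=1}^n\bigl(1+t^jq^{\mu_{n-j+1}}\bigr).$$ A Macdonald polynomial $P_\mu(y|q,t)$ of type $C_n$ is a Laurent polynomial with complex coefficients of the form $P_\mu=m_\mu+\sum_{\nu<\mu}a_{\mu\nu}m_\nu$ (sum over partitions $\nu<\mu$) satisfying $E P_\mu=c_\mu P_\mu$. Theorem. The Laurent polynomial $$\frac{(q)_\lambda}{(t)_\lambda}\sum_{\substack{i_1+\cdots+i_{2n}=\lambda\\ i_1,\dots,i_{2n}\ge0}}\frac{(t)_{i_1}\cdots(t)_{i_{2n}}}{(q)_{i_1}\cdots(q)_{i_{2n}}}\;y_1^{i_1-i_{2n}}y_2^{i_2-i_{2n-1}}\cdots y_n^{i_n-i_{n+1}}$$ is a Macdonald polynomial $P_{(\lambda,0,\dots,0)}(y|q,t)$ of type $C_n$. Moreover it is the only one whenever $t<1$ and, more generally, whenever $c_\nu\ne c_{(\lambda,0,\dots,0)}$ for all partitions $\nu<(\lambda,0,\dots,0)$. -/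

import Mathlib

open Finset BigOperators

noncomputable section

/-- The `q`-shifted factorial `(a)_m = ∏_{0 ≤ k < m} (1 - a q^k)`. -/
def qShifted (q a : ℝ) (m : ℕ) : ℝ := ∏ k ∈ range m, (1 - a * q ^ k)

/-- The group algebra `A = ℂ[P]` of the weight lattice `P = ⨁ ℤ ε_i` of type `C_n`, i.e. the
algebra of Laurent polynomials in `y_1, …, y_n`, where `y_i = e^{ε_i}`. -/
abbrev CnAlgebra (n : ℕ) : Type := AddMonoidAlgebra ℂ (Fin n → ℤ)

/-- The monomial `e^ν = y_1^{ν_1} ⋯ y_n^{ν_n}`. -/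
def expWeight {n : ℕ} (ν : Fin n → ℤ) : CnAlgebra n := AddMonoidAlgebra.single ν 1

/-- The value of a Laurent polynomial at a point `y` (used at points with nonzero coordinates). -/
def laurentEval {n : ℕ} (P : CnAlgebra n) (y : Fin n → ℂ) : ℂ :=
  P.coeff.sum fun ν c => c * ∏ i, y i ^ ν i

/-- The action of the signed permutation `(ε, σ)`, an element of the Weyl group `W(C_n)`,
on a weight. -/
def signedPerm {n : ℕ} (w : (Fin n → ℤˣ) × Equiv.Perm (Fin n)) (ν : Fin n → ℤ) : Fin n → ℤ :=
  fun i => (w.1 i : ℤ) * ν (w.2 i)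

/-- The orbit `W μ` under the Weyl group of type `C_n`. -/
def weylOrbit {n : ℕ} (μ : Fin n → ℤ) : Finset (Fin n → ℤ) :=
  univ.image fun w : (Fin n → ℤˣ) × Equiv.Perm (Fin n) => signedPerm w μ

/-- The orbit sum `m_μ = ∑_{ν ∈ W μ} e^ν`. -/
def orbitSum {n : ℕ} (μ : Fin n → ℤ) : CnAlgebra n := ∑ ν ∈ weylOrbit μ, expWeight ν

/-- Partitions `μ_1 ≥ ⋯ ≥ μ_n ≥ 0`, i.e. the dominant weights of type `C_n`. -/
def IsPartition {n : ℕ} (μ : Fin n → ℤ) : Prop := Antitone μ ∧ ∀ i, 0 ≤ μ i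

/-- The positive roots `ε_i ± ε_j` (`i < j`) and `2 ε_i` of type `C_n`. -/
def positiveRoots (n : ℕ) : Set (Fin n → ℤ) :=
  {α | (∃ i j, i < j ∧ (α = Pi.single i 1 - Pi.single j 1 ∨ α = Pi.single i 1 + Pi.single j 1)) ∨
    ∃ i, α = Pi.single i 2}

/-- The positive cone `Q⁺` of the root lattice: nonnegative integral combinations of the
positive roots. -/
def positiveCone (n : ℕ) : AddSubmonoid (Fin n → ℤ) := AddSubmonoid.closure (positiveRoots n)

/-- The strict order `ν < μ` on weights: `μ - ν ∈ Q⁺` and `ν ≠ μ`. -/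
def WeightLT {n : ℕ} (ν μ : Fin n → ℤ) : Prop := μ - ν ∈ positiveCone n ∧ ν ≠ μ

/-- The shift `∏_i T_{y_i}^{a_i / 2}`, where `T_{y_i}` replaces `y_i` by `q y_i`. -/
def halfShift {n : ℕ} (q : ℝ) (a : Fin n → ℤˣ) (f : (Fin n → ℂ) → ℂ) (y : Fin n → ℂ) : ℂ :=
  f fun i => ((√q : ℝ) : ℂ) ^ (a i : ℤ) * y i

/-- Macdonald's `q`-difference operator of type `C_n` (with `t_1 = t_2 = t`):
`E = ∑_{a ∈ {±1}^n} ∏_{i<j} (1 - t y_i^{a_i} y_j^{a_j}) / (1 - y_i^{a_i} y_j^{a_j})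
  ∏_i (1 - t y_i^{2 a_i}) / (1 - y_i^{2 a_i}) T_{y_i}^{a_i / 2}`. -/
def macdonaldOp {n : ℕ} (q t : ℝ) (f : (Fin n → ℂ) → ℂ) (y : Fin n → ℂ) : ℂ :=
  ∑ a : Fin n → ℤˣ,
    (∏ i, ∏ j ∈ Ioi i, (1 - t * (y i ^ (a i : ℤ) * y j ^ (a j : ℤ))) /
        (1 - y i ^ (a i : ℤ) * y j ^ (a j : ℤ))) *
      (∏ i, (1 - t * y i ^ (2 * (a i : ℤ))) / (1 - y i ^ (2 * (a i : ℤ)))) *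
      halfShift q a f y

/-- Points of the torus `(ℂ ∖ {0})^n` at which no denominator of the operator vanishes. -/
def IsRegularPoint {n : ℕ} (y : Fin n → ℂ) : Prop :=
  (∀ i, y i ≠ 0) ∧
    (∀ i j, i < j → ∀ a b : ℤˣ, y i ^ (a : ℤ) * y j ^ (b : ℤ) ≠ 1) ∧
    ∀ i, ∀ a : ℤˣ, y i ^ (2 * (a : ℤ)) ≠ 1

/-- The eigenvalue
`c_μ = q^{-(μ_1 + ⋯ + μ_n) / 2} ∏_{1 ≤ j ≤ n} (1 + t^j q^{μ_{n-j+1}})`. Here `j = i + 1` for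
`i : Fin n`, and `Fin.rev i` is the (zero-based) position of `μ_{n-j+1}`. -/
def macdonaldEigenvalue {n : ℕ} (q t : ℝ) (μ : Fin n → ℤ) : ℝ :=
  (√q) ^ (-∑ i, μ i) * ∏ i : Fin n, (1 + t ^ ((i : ℕ) + 1) * q ^ μ (Fin.rev i))

/-- `P` is a Macdonald polynomial `P_μ(y | q, t)` of type `C_n`: it has the form
`m_μ + ∑_{ν < μ} a_{μν} m_ν`, where `ν` runs over partitions, and `E P = c_μ P`. -/
def IsMacdonaldPolynomial {n : ℕ} (q t : ℝ) (μ : Fin n → ℤ) (P : CnAlgebra n) : Prop :=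
  (∃ a : (Fin n → ℤ) →₀ ℂ, (∀ ν ∈ a.support, IsPartition ν ∧ WeightLT ν μ) ∧
    P = orbitSum μ + a.sum fun ν c => c • orbitSum ν) ∧
  ∀ y : Fin n → ℂ, IsRegularPoint y →
    macdonaldOp q t (laurentEval P) y = (macdonaldEigenvalue q t μ : ℂ) * laurentEval P y

/-- The partition `(l, 0, …, 0)`. -/
def rowPartition (n l : ℕ) : Fin n → ℤ := fun i => if (i : ℕ) = 0 then (l : ℤ) else 0

/-- For `i = (i_1, …, i_{2n})`, the exponent
`(i_1 - i_{2n}, i_2 - i_{2n-1}, …, i_n - i_{n+1})`. -/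
def rowExponent {n : ℕ} (i : Fin (2 * n) → ℕ) : Fin n → ℤ := fun k =>
  (i (Fin.castLE (by omega) k) : ℤ) - (i (Fin.rev (Fin.castLE (by omega) k)) : ℤ)

/-- The Laurent polynomial `(q)_l / (t)_l ∑_{i_1 + ⋯ + i_{2n} = l}
(t)_{i_1} ⋯ (t)_{i_{2n}} / ((q)_{i_1} ⋯ (q)_{i_{2n}}) y_1^{i_1 - i_{2n}} ⋯ y_n^{i_n - i_{n+1}}`. -/
def rowFormula (n l : ℕ) (q t : ℝ) : CnAlgebra n :=
  ((qShifted q q l / qShifted q t l : ℝ) : ℂ) •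
    ∑ i ∈ piAntidiag (univ : Finset (Fin (2 * n))) l,
      ((∏ k, qShifted q t (i k) / qShifted q q (i k) : ℝ) : ℂ) • expWeight (rowExponent i)

end

/-! Eigenvalue equation. Let `F(X) = ∑ (t)_m/(q)_m X^m`, so that `(1 - X) F(X) = (1 - tX) F(qX)`. Up
to the factor `(q)_λ/(t)_λ`, the one-row polynomial is the coefficient of `X^λ` in `G = ∏ F(y_i X)
F(y_i⁻¹ X)`. With `z_i = y_i^{a_i}`, a half shift followed by `X ↦ q^{1/2} X` turns `G` into `∏ F(q
z_i X) F(z_i⁻¹ X)`. Multiplying by `D = ∏ (1 - y_i X)(1 - y_i⁻¹ X)` makes every such product, and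
`G` itself, a polynomial times the common series `H = ∏ F(q y_i X) F(q y_i⁻¹ X)`, and `H` is `G` at
`qX`. The equation thus becomes the polynomial identity `pfDiff = 0`. That is proved by induction on
the number of variables: evaluation at the `2n` roots of `D` reduces to the sum of the shift
coefficients in one variable fewer, and the constant term of the identity gives this sum for the
next step (`pfDiff_eval_root`, `pfDiff_eq_zero_of_roots`, `sum_shiftCoeff`).

Triangularity. The coefficients are invariant under signed permutations, and each exponent has
coordinate sum `λ` minus an even nonnegative integer. For a partition this already places it below
`(λ, 0, …, 0)`.

Uniqueness. The difference of two solutions is an invariant eigenfunction. Letting `y` go to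
infinity in a generic strictly dominant direction isolates its leading weight `ν`, a partition, and
forces `c_ν = c_μ` (`eigenvalue_eq_of_leading_weight`). For `t < 1` this is impossible, since moving
boxes to the first row, and then lengthening that row, increases the eigenvalue
(`macdonaldEigenvalue_lt`). -/

noncomputable section

open Filter Topology

/-! ### Shift coefficients and regular points -/

/-- The coefficient of a shift in Macdonald's operator, as a function of `z_i = y_i^{a_i}`. -/
def shiftCoeff {n : ℕ} (t : ℂ) (z : Fin n → ℂ) : ℂ :=
  (∏ i, ∏ j ∈ Ioi i, (1 - t * (z i * z j)) / (1 - z i * z j)) *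
    ∏ i, (1 - t * z i ^ 2) / (1 - z i ^ 2)

/-- The point `(y_1^{a_1}, …, y_n^{a_n})`. -/
def signedPoint {n : ℕ} (y : Fin n → ℂ) (a : Fin n → ℤˣ) : Fin n → ℂ := fun i => y i ^ (a i : ℤ)

/-- Separates the pairs containing `k` from the others. Symmetry of `g` is needed because `k` may be
the larger or the smaller index of a pair. -/
lemma prod_Ioi_succAbove {M : Type*} [CommMonoid M] {n : ℕ} (g : Fin (n + 1) → Fin (n + 1) → M)
    (hg : ∀ i j, g i j = g j i) (k : Fin (n + 1)) :
    ∏ i, ∏ j ∈ Ioi i, g i j =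
      (∏ i, g k (k.succAbove i)) *
        ∏ i, ∏ j ∈ Ioi i, g (k.succAbove i) (k.succAbove j) := by
  have key : ∀ (m : ℕ) (h : Fin m → Fin m → M),
      ∏ i, ∏ j ∈ Ioi i, h i j = ∏ i, ∏ j, if i < j then h i j else 1 := by
    intro m h
    refine prod_congr rfl fun i _ => ?_
    rw [← prod_filter]
    congr 1
    ext j
    simp
  rw [key, key, Fin.prod_univ_succAbove _ k, Fin.prod_univ_succAbove _ k]
  simp only [lt_irrefl, if_false, one_mul]
  have : ∀ i : Fin n, (∏ j, if k.succAbove i < j then g (k.succAbove i) j else 1) =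
      (if k.succAbove i < k then g k (k.succAbove i) else 1) *
        ∏ j, if i < j then g (k.succAbove i) (k.succAbove j) else 1 := by
    intro i
    rw [Fin.prod_univ_succAbove _ k, hg]
    simp only [Fin.succAbove_lt_succAbove_iff]
  simp only [this, prod_mul_distrib]
  rw [← mul_assoc, ← prod_mul_distrib]
  congr 1
  refine prod_congr rfl fun i _ => ?_
  rcases lt_or_gt_of_ne (Fin.succAbove_ne k i) with h | h
  · simp [h, h.not_gt]
  · simp [h, h.not_gt]

lemma shiftCoeff_succAbove {n : ℕ} (t : ℂ) (z : Fin (n + 1) → ℂ) (k : Fin (n + 1)) :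
    shiftCoeff t z = (1 - t * z k ^ 2) / (1 - z k ^ 2) *
      (∏ i, (1 - t * (z k * z (k.succAbove i))) / (1 - z k * z (k.succAbove i))) *
      shiftCoeff t (fun i => z (k.succAbove i)) := by
  unfold shiftCoeff
  rw [prod_Ioi_succAbove _ (fun i j => by rw [mul_comm (z i)]) k, Fin.prod_univ_succAbove _ k]
  ring

lemma IsRegularPoint.succAbove {n : ℕ} {y : Fin (n + 1) → ℂ} (hy : IsRegularPoint y)
    (k : Fin (n + 1)) : IsRegularPoint fun i => y (k.succAbove i) :=
  ⟨fun _ => hy.1 _, fun _ _ hij => hy.2.1 _ _ (Fin.succAbove_lt_succAbove_iff.2 hij),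
    fun _ => hy.2.2 _⟩

lemma IsRegularPoint.mul_ne_one {n : ℕ} {y : Fin n → ℂ} (hy : IsRegularPoint y) {i j : Fin n}
    (hij : i ≠ j) (a b : ℤˣ) : y i ^ (a : ℤ) * y j ^ (b : ℤ) ≠ 1 := by
  rcases lt_or_gt_of_ne hij with h | h
  · exact hy.2.1 i j h a b
  · rw [mul_comm]
    exact hy.2.1 j i h b a

lemma IsRegularPoint.sq_ne_one {n : ℕ} {y : Fin n → ℂ} (hy : IsRegularPoint y) (i : Fin n)
    (a : ℤˣ) : (y i ^ (a : ℤ)) ^ 2 ≠ 1 := by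
  have := hy.2.2 i a
  rwa [mul_comm, zpow_mul, zpow_ofNat] at this

/-- A function of `x` and `x⁻¹` that is symmetric does not change under `x ↦ x^{±1}`. -/
lemma symm_zpow_unit {M : Type*} (F : ℂ → ℂ → M) (hF : ∀ b c, F b c = F c b) (x : ℂ) (a : ℤˣ) :
    F (x ^ (a : ℤ)) (x ^ (a : ℤ))⁻¹ = F x x⁻¹ := by
  rcases Int.units_eq_one_or a with rfl | rfl
  · simp
  · simp [hF x⁻¹ x]

/-! ### The partial fraction identity -/

open Polynomial in
/-- The polynomial `(1 - b X) (1 - c X)`. -/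
def linPair (b c : ℂ) : ℂ[X] := (1 - C b * X) * (1 - C c * X)

lemma linPair_comm (b c : ℂ) : linPair b c = linPair c b := mul_comm _ _

lemma linPair_eval (b c v : ℂ) : (linPair b c).eval v = (1 - b * v) * (1 - c * v) := by
  simp [linPair]

lemma linPair_natDegree_le (b c : ℂ) : (linPair b c).natDegree ≤ 2 := by
  unfold linPair
  compute_degree

lemma linPair_coeff_two (b c : ℂ) : (linPair b c).coeff 2 = b * c := by
  have : linPair b c = Polynomial.C (b * c) * Polynomial.X ^ 2 -
      Polynomial.C (b + c) * Polynomial.X + 1 := by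
    simp only [linPair, map_add, map_mul]; ring
  rw [this]
  simp only [Polynomial.coeff_add, Polynomial.coeff_sub, Polynomial.coeff_C_mul]
  simp [Polynomial.coeff_X, Polynomial.coeff_one]

lemma prod_linPair_natDegree_le {n : ℕ} (b c : Fin n → ℂ) :
    (∏ i, linPair (b i) (c i)).natDegree ≤ n * 2 := by
  refine (Polynomial.natDegree_prod_le _ _).trans ?_
  refine (sum_le_sum fun i _ => linPair_natDegree_le _ _).trans ?_
  simp

lemma prod_linPair_coeff {n : ℕ} (b c : Fin n → ℂ) :
    (∏ i, linPair (b i) (c i)).coeff (n * 2) = ∏ i, (b i * c i) := by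
  have := Polynomial.coeff_prod_of_natDegree_le (univ : Finset (Fin n))
    (fun i => linPair (b i) (c i)) 2 (fun i _ => linPair_natDegree_le _ _)
  simpa [linPair_coeff_two] using this

lemma prod_linPair_eval {n : ℕ} (b c : Fin n → ℂ) (v : ℂ) :
    (∏ i, linPair (b i) (c i)).eval v = ∏ i, ((1 - b i * v) * (1 - c i * v)) := by
  rw [Polynomial.eval_prod]
  simp [linPair_eval]

/-- The difference of the two sides of the partial fraction identity, times the denominator. -/
def pfDiff {n : ℕ} (t : ℂ) (y : Fin n → ℂ) (p : ℂ) : Polynomial ℂ :=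
  (∑ a : Fin n → ℤˣ, Polynomial.C (shiftCoeff t (signedPoint y a)) *
      ∏ i, linPair (t * (signedPoint y a i)⁻¹) (signedPoint y a i)) -
    Polynomial.C p * (Polynomial.C (t ^ n) * ∏ i, linPair (y i) (y i)⁻¹ +
      ∏ i, linPair (t * y i) (t * (y i)⁻¹))

lemma pfDiff_natDegree_le {n : ℕ} (t : ℂ) (y : Fin n → ℂ) (p : ℂ) :
    (pfDiff t y p).natDegree ≤ n * 2 := by
  have h : ∀ (c : ℂ) (b d : Fin n → ℂ),
      (Polynomial.C c * ∏ i, linPair (b i) (d i)).natDegree ≤ n * 2 := fun c b d =>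
    (Polynomial.natDegree_C_mul_le _ _).trans (prod_linPair_natDegree_le b d)
  refine (Polynomial.natDegree_sub_le_of_le
    (Polynomial.natDegree_sum_le_of_forall_le _ _ fun a _ => h _ _ _)
    ((Polynomial.natDegree_C_mul_le _ _).trans
      (Polynomial.natDegree_add_le_of_degree_le (h _ _ _) (prod_linPair_natDegree_le _ _)))).trans
    (max_self _).le

lemma signedPoint_ne_zero {n : ℕ} {y : Fin n → ℂ} (hy : ∀ i, y i ≠ 0) (a : Fin n → ℤˣ)
    (i : Fin n) : signedPoint y a i ≠ 0 := zpow_ne_zero _ (hy i)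

/-- The products in the sum all have top coefficient `t^n`, and the two subtracted ones give `t^n`
and `t^(2n)`. Hence the top coefficient is `t^n` times the constant term computed in
`pfDiff_eval_zero`. -/
lemma pfDiff_coeff_top {n : ℕ} (t : ℂ) {y : Fin n → ℂ} (hy : ∀ i, y i ≠ 0) (p : ℂ) :
    (pfDiff t y p).coeff (n * 2) =
      t ^ n * ((∑ a : Fin n → ℤˣ, shiftCoeff t (signedPoint y a)) - p * (1 + t ^ n)) := by
  have h1 : ∀ a : Fin n → ℤˣ, ∏ i, (t * (signedPoint y a i)⁻¹ * signedPoint y a i) = t ^ n := by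
    intro a
    simp [mul_assoc, inv_mul_cancel₀ (signedPoint_ne_zero hy a _)]
  have h2 : ∏ i, (y i * (y i)⁻¹) = 1 := by simp [hy]
  have h3 : ∏ i, (t * y i * (t * (y i)⁻¹)) = t ^ n * t ^ n := by
    have : ∀ i, t * y i * (t * (y i)⁻¹) = t * t := fun i => by
      have := hy i
      field_simp
    simp [this, mul_pow]
  simp only [pfDiff, Polynomial.coeff_sub, Polynomial.finsetSum_coeff, Polynomial.coeff_C_mul,
    Polynomial.coeff_add, prod_linPair_coeff, h1, h2, h3, ← sum_mul]
  ring

lemma pfDiff_eval_zero {n : ℕ} (t : ℂ) (y : Fin n → ℂ) (p : ℂ) :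
    (pfDiff t y p).eval 0 =
      (∑ a : Fin n → ℤˣ, shiftCoeff t (signedPoint y a)) - p * (1 + t ^ n) := by
  simp only [pfDiff, Polynomial.eval_sub, Polynomial.eval_finsetSum, Polynomial.eval_mul,
    Polynomial.eval_C, Polynomial.eval_add, prod_linPair_eval]
  simp only [mul_zero, sub_zero, mul_one, prod_const_one]
  ring

lemma pfDiff_eval_root {n : ℕ} (t : ℂ) {y : Fin (n + 1) → ℂ} (hy : IsRegularPoint y) (p : ℂ)
    (k : Fin (n + 1)) (e : ℤˣ)
    (hp : ∑ a : Fin n → ℤˣ, shiftCoeff t (signedPoint (fun i => y (k.succAbove i)) a) = p) :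
    (pfDiff t y p).eval (y k ^ (e : ℤ)) = 0 := by
  set w := y k ^ (e : ℤ) with hw
  have hw0 : w ≠ 0 := zpow_ne_zero _ (hy.1 k)
  have hsplit : ∀ a : Fin n → ℤˣ, (∏ i, linPair (t * (signedPoint (fun i => y (k.succAbove i)) a i)⁻¹)
      (signedPoint (fun i => y (k.succAbove i)) a i)).eval w *
      (∏ i, (1 - t * (w * signedPoint (fun i => y (k.succAbove i)) a i)) /
        (1 - w * signedPoint (fun i => y (k.succAbove i)) a i))
      = ∏ i, (1 - t * y (k.succAbove i) * w) * (1 - t * (y (k.succAbove i))⁻¹ * w) := by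
    intro a
    rw [prod_linPair_eval, ← prod_mul_distrib]
    refine prod_congr rfl fun i _ => ?_
    rw [← symm_zpow_unit (fun b c => (1 - t * b * w) * (1 - t * c * w))
      (fun b c => mul_comm _ _) (y (k.succAbove i)) (a i)]
    have h := hy.mul_ne_one (Fin.succAbove_ne k i).symm e (a i)
    rw [← hw] at h
    have h' : 1 - w * y (k.succAbove i) ^ (a i : ℤ) ≠ 0 := sub_ne_zero.2 h.symm
    simp only [signedPoint]
    rw [mul_div_assoc', div_eq_iff h']
    ring
  -- If the sign at `k` is `-e`, the factor `1 - z_k w` is zero. If it is `e`, that factor is `1 - w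
  -- ^ 2` and cancels the denominator, leaving the shift coefficient in the remaining variables.
  have hterm : ∀ x : ℤˣ × (Fin n → ℤˣ),
      (Polynomial.C (shiftCoeff t (signedPoint y (Fin.insertNthEquiv (fun _ => ℤˣ) k x))) *
        ∏ i, linPair (t * (signedPoint y (Fin.insertNthEquiv (fun _ => ℤˣ) k x) i)⁻¹)
          (signedPoint y (Fin.insertNthEquiv (fun _ => ℤˣ) k x) i)).eval w =
      if x.1 = e then (1 - t) * (1 - t * w ^ 2) *
        (∏ i, (1 - t * y (k.succAbove i) * w) * (1 - t * (y (k.succAbove i))⁻¹ * w)) *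
        shiftCoeff t (signedPoint (fun i => y (k.succAbove i)) x.2) else 0 := by
    rintro ⟨b, a⟩
    have hk : signedPoint y (Fin.insertNthEquiv (fun _ => ℤˣ) k (b, a)) k = y k ^ (b : ℤ) := by
      simp [signedPoint]
    have hi : ∀ i, signedPoint y (Fin.insertNthEquiv (fun _ => ℤˣ) k (b, a)) (k.succAbove i) =
        signedPoint (fun i => y (k.succAbove i)) a i := by
      simp [signedPoint]
    rw [Polynomial.eval_mul, Polynomial.eval_C, Fin.prod_univ_succAbove _ k, Polynomial.eval_mul,
      linPair_eval, shiftCoeff_succAbove t _ k]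
    simp only [hk, hi]
    split_ifs with hb
    · obtain rfl : b = e := hb
      rw [← hw, ← hsplit a]
      have h := hy.sq_ne_one k b
      rw [← hw] at h
      have h' : 1 - w ^ 2 ≠ 0 := sub_ne_zero.2 h.symm
      have hc : (1 - t * w ^ 2) / (1 - w ^ 2) * ((1 - t * w⁻¹ * w) * (1 - w * w)) =
          (1 - t) * (1 - t * w ^ 2) := by
        field_simp
      linear_combination ((∏ i, (1 - t * (w * signedPoint (fun i => y (k.succAbove i)) a i)) /
        (1 - w * signedPoint (fun i => y (k.succAbove i)) a i)) *
        (∏ i, linPair (t * (signedPoint (fun i => y (k.succAbove i)) a i)⁻¹)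
          (signedPoint (fun i => y (k.succAbove i)) a i)).eval w *
        shiftCoeff t (signedPoint (fun i => y (k.succAbove i)) a)) * hc
    · have hb' : b = -e := Int.units_ne_iff_eq_neg.1 hb
      have : y k ^ (b : ℤ) * w = 1 := by
        rw [hw, hb', ← zpow_add₀ (hy.1 k)]
        simp
      rw [this]
      ring
  rw [pfDiff, Polynomial.eval_sub, Polynomial.eval_finsetSum,
    ← (Fin.insertNthEquiv (fun _ => ℤˣ) k).sum_comp, sum_congr rfl fun x _ => hterm x,
    Fintype.sum_prod_type_right]
  simp only [sum_ite_eq', mem_univ, if_true, ← mul_sum, hp]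
  simp only [Polynomial.eval_mul, Polynomial.eval_add, Polynomial.eval_C, prod_linPair_eval]
  rw [Fin.prod_univ_succAbove _ k, Fin.prod_univ_succAbove _ k,
    ← symm_zpow_unit (fun b c => (1 - b * w) * (1 - c * w)) (fun b c => mul_comm _ _) (y k) e,
    ← symm_zpow_unit (fun b c => (1 - t * b * w) * (1 - t * c * w)) (fun b c => mul_comm _ _)
      (y k) e, ← hw, inv_mul_cancel₀ hw0, mul_assoc t w⁻¹, inv_mul_cancel₀ hw0]
  ring

lemma signedRoot_injective {n : ℕ} {y : Fin n → ℂ} (hy : IsRegularPoint y) :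
    Function.Injective fun x : Fin n × ℤˣ => y x.1 ^ (x.2 : ℤ) := by
  rintro ⟨i, a⟩ ⟨j, b⟩ h
  simp only at h
  have h1 : y i ^ (a : ℤ) * y j ^ ((-b : ℤˣ) : ℤ) = 1 := by
    rw [h, ← zpow_add₀ (hy.1 j)]
    simp
  by_cases hij : i = j
  · subst hij
    by_cases hab : a = b
    · rw [hab]
    · rw [← Int.units_ne_iff_eq_neg.1 hab, ← sq] at h1
      exact absurd h1 (hy.sq_ne_one i a)
  · exact absurd h1 (hy.mul_ne_one hij a (-b))

/-- Vanishing at the `2n` distinct roots of `D = ∏ (1 - y_i X)(1 - y_i⁻¹ X)` makes the difference a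
multiple `c D`. The top and constant coefficients of `D` are both `1`, while those of `pfDiff`
differ by the factor `t^n`; so `c = t^n c`, and `c = 0`. -/
lemma pfDiff_eq_zero_of_roots {n : ℕ} {t : ℂ} {y : Fin n → ℂ} (hy : IsRegularPoint y) {p : ℂ}
    (ht : t ^ n ≠ 1) (h : ∀ k (e : ℤˣ), (pfDiff t y p).eval (y k ^ (e : ℤ)) = 0) :
    pfDiff t y p = 0 := by
  set N := pfDiff t y p with hN
  have hDev : ∀ k (e : ℤˣ), (∏ i, linPair (y i) (y i)⁻¹).eval (y k ^ (e : ℤ)) = 0 := by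
    intro k e
    rw [prod_linPair_eval]
    refine prod_eq_zero (mem_univ k) ?_
    rw [← symm_zpow_unit (fun b c => (1 - b * _) * (1 - c * _)) (fun b c => mul_comm _ _) (y k) e,
      inv_mul_cancel₀ (zpow_ne_zero _ (hy.1 k))]
    ring
  have hcoeff : (∏ i, linPair (y i) (y i)⁻¹).coeff (n * 2) = 1 := by
    rw [prod_linPair_coeff]
    simp [hy.1]
  have hdeg : (N - Polynomial.C (N.coeff (n * 2)) * ∏ i, linPair (y i) (y i)⁻¹).degree <
      ((univ : Finset (Fin n × ℤˣ)).image fun x => y x.1 ^ (x.2 : ℤ)).card := by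
    rw [card_image_of_injective _ (signedRoot_injective hy)]
    have hcard : (univ : Finset (Fin n × ℤˣ)).card = n * 2 := by
      rw [card_univ, Fintype.card_prod, Fintype.card_fin, Fintype.card_units_int]
    rw [hcard, Polynomial.degree_lt_iff_coeff_zero]
    intro m hm
    rcases hm.eq_or_lt with rfl | hm
    · simp [hcoeff]
    · refine Polynomial.coeff_eq_zero_of_natDegree_lt (lt_of_le_of_lt ?_ hm)
      exact (Polynomial.natDegree_sub_le_of_le (pfDiff_natDegree_le _ _ _)
        ((Polynomial.natDegree_C_mul_le _ _).trans (prod_linPair_natDegree_le _ _))).trans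
        (max_self _).le
  have hzero : N - Polynomial.C (N.coeff (n * 2)) * ∏ i, linPair (y i) (y i)⁻¹ = 0 := by
    refine Polynomial.eq_zero_of_degree_lt_of_eval_finset_eq_zero _ hdeg ?_
    simp only [mem_image, mem_univ, true_and, forall_exists_index]
    rintro _ ⟨k, e⟩ rfl
    simp [h, hDev]
  have h0 : N.eval 0 = N.coeff (n * 2) := by
    have := congrArg (Polynomial.eval 0) hzero
    simp only [Polynomial.eval_sub, Polynomial.eval_mul, Polynomial.eval_C, prod_linPair_eval] at this
    simpa [sub_eq_zero] using this
  have htop : N.coeff (n * 2) = t ^ n * N.coeff (n * 2) := by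
    conv_rhs => rw [← h0]
    rw [hN, pfDiff_coeff_top t hy.1, pfDiff_eval_zero]
  have : N.coeff (n * 2) = 0 := by
    have h2 : (1 - t ^ n) * N.coeff (n * 2) = 0 := by linear_combination htop
    rcases mul_eq_zero.1 h2 with h2 | h2
    · exact absurd (sub_eq_zero.1 h2).symm ht
    · exact h2
  rwa [this, map_zero, zero_mul, sub_zero] at hzero

lemma shiftCoeff_one {n : ℕ} {y : Fin n → ℂ} (hy : IsRegularPoint y) (a : Fin n → ℤˣ) :
    shiftCoeff 1 (signedPoint y a) = 1 := by
  unfold shiftCoeff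
  rw [prod_eq_one, prod_eq_one, one_mul]
  · intro i _
    rw [one_mul]
    exact div_self (sub_ne_zero.2 (hy.sq_ne_one i _).symm)
  · intro i _
    refine prod_eq_one fun j hj => ?_
    rw [one_mul]
    exact div_self (sub_ne_zero.2 (hy.2.1 i j (mem_Ioi.1 hj) _ _).symm)

/-- `∏_{j=1}^m (1 + t^j)`. -/
def poincareProd (t : ℂ) (m : ℕ) : ℂ := ∏ j ∈ range m, (1 + t ^ (j + 1))

/-- The case `t = 1`, where comparing top and constant coefficients gives nothing. All shift
coefficients are `1` and all products equal `D`, so the identity reads `2^(n+1) D = 2^n (D + D)`. -/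
lemma pfDiff_one {n : ℕ} {y : Fin (n + 1) → ℂ} (hy : IsRegularPoint y) :
    pfDiff 1 y (poincareProd 1 n) = 0 := by
  have : ∀ a : Fin (n + 1) → ℤˣ, ∏ i, linPair (1 * (signedPoint y a i)⁻¹) (signedPoint y a i) =
      ∏ i, linPair (y i) (y i)⁻¹ := by
    intro a
    refine prod_congr rfl fun i _ => ?_
    rw [one_mul, linPair_comm]
    exact symm_zpow_unit linPair linPair_comm _ _
  simp only [pfDiff, shiftCoeff_one hy, this]
  simp only [one_mul, one_pow, poincareProd, map_one]
  simp only [sum_const, card_univ, Fintype.card_fun, Fintype.card_units_int, Fintype.card_fin,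
    prod_const, card_range, nsmul_eq_mul]
  have h2 : Polynomial.C ((1 + 1 : ℂ) ^ n) = (2 : Polynomial ℂ) ^ n := by
    rw [map_pow, one_add_one_eq_two]; rfl
  rw [h2]
  push_cast
  ring

lemma pfDiff_eq_zero_of_sum {n : ℕ} {t : ℝ} (ht : 0 < t) {y : Fin (n + 1) → ℂ}
    (hy : IsRegularPoint y)
    (ih : ∀ x : Fin n → ℂ, IsRegularPoint x →
      ∑ a : Fin n → ℤˣ, shiftCoeff t (signedPoint x a) = poincareProd t n) :
    pfDiff (t : ℂ) y (poincareProd t n) = 0 := by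
  by_cases h1 : t = 1
  · subst h1
    simpa using pfDiff_one hy
  · refine pfDiff_eq_zero_of_roots hy ?_ fun k e => pfDiff_eval_root _ hy _ k e (ih _ (hy.succAbove k))
    intro h
    have h : t ^ (n + 1) = 1 := by exact_mod_cast h
    exact h1 ((pow_eq_one_iff_of_nonneg ht.le (by omega)).1 h)

/-- Macdonald's summation formula for the minuscule weight of type `C_n`. -/
lemma sum_shiftCoeff {n : ℕ} {t : ℝ} (ht : 0 < t) {y : Fin n → ℂ} (hy : IsRegularPoint y) :
    ∑ a : Fin n → ℤˣ, shiftCoeff t (signedPoint y a) = poincareProd t n := by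
  induction n with
  | zero => simp [shiftCoeff, poincareProd]
  | succ n ih =>
    -- The constant term of the identity reads `∑ = p (1 + t^(n+1))`, which supplies the new factor
    -- of the product.
    have h := congrArg (Polynomial.eval 0) (pfDiff_eq_zero_of_sum ht hy fun x hx => ih hx)
    rw [pfDiff_eval_zero, Polynomial.eval_zero, sub_eq_zero] at h
    rw [h, poincareProd, poincareProd, prod_range_succ]

/-- The partial fraction identity behind the eigenvalue equation. -/
theorem pfDiff_eq_zero {n : ℕ} {t : ℝ} (ht : 0 < t) {y : Fin (n + 1) → ℂ}
    (hy : IsRegularPoint y) : pfDiff (t : ℂ) y (poincareProd t n) = 0 :=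
  pfDiff_eq_zero_of_sum ht hy fun _ hx => sum_shiftCoeff ht hx

/-! ### The `q`-binomial series and the generating function -/

/-- The coefficients `(t)_m / (q)_m` of the `q`-binomial series. -/
def qBinomCoeff (q t : ℝ) (m : ℕ) : ℝ := qShifted q t m / qShifted q q m

/-- The `q`-binomial series `∑ (t)_m / (q)_m X^m`. -/
def qBinomSeries (q t : ℝ) : PowerSeries ℂ := PowerSeries.mk fun m => (qBinomCoeff q t m : ℂ)

lemma qShifted_succ (q a : ℝ) (m : ℕ) : qShifted q a (m + 1) = qShifted q a m * (1 - a * q ^ m) :=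
  prod_range_succ _ _

lemma qShifted_self_ne_zero {q : ℝ} (hq0 : 0 < q) (hq1 : q < 1) (m : ℕ) : qShifted q q m ≠ 0 := by
  refine prod_ne_zero_iff.2 fun k _ => ?_
  rw [← pow_succ']
  exact sub_ne_zero.2 (pow_lt_one₀ hq0.le hq1 (by omega)).ne'

lemma qBinomCoeff_succ {q : ℝ} (hq0 : 0 < q) (hq1 : q < 1) (t : ℝ) (m : ℕ) :
    qBinomCoeff q t (m + 1) * (1 - q ^ (m + 1)) = qBinomCoeff q t m * (1 - t * q ^ m) := by
  have h1 := qShifted_self_ne_zero hq0 hq1 m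
  have h2 := qShifted_self_ne_zero hq0 hq1 (m + 1)
  have h3 := qShifted_succ q q m
  unfold qBinomCoeff
  rw [div_mul_eq_mul_div, div_mul_eq_mul_div, div_eq_div_iff h2 h1, h3, qShifted_succ]
  ring

/-- The functional equation `(1 - cX) F(cX) = (1 - tcX) F(qcX)`, which is the two-term recursion of
the coefficients. -/
lemma rescale_qBinomSeries {q : ℝ} (hq0 : 0 < q) (hq1 : q < 1) (t : ℝ) (c : ℂ) :
    (1 - PowerSeries.C c * PowerSeries.X) * PowerSeries.rescale c (qBinomSeries q t) =
      (1 - PowerSeries.C (t * c) * PowerSeries.X) *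
        PowerSeries.rescale (q * c) (qBinomSeries q t) := by
  ext m
  simp only [sub_mul, one_mul, map_sub, mul_assoc, PowerSeries.coeff_C_mul]
  cases m with
  | zero => simp
  | succ m =>
    have h : (qBinomCoeff q t (m + 1) : ℂ) * (1 - (q : ℂ) ^ (m + 1)) =
        qBinomCoeff q t m * (1 - t * (q : ℂ) ^ m) := by
      exact_mod_cast qBinomCoeff_succ hq0 hq1 t m
    simp only [PowerSeries.coeff_succ_X_mul, PowerSeries.coeff_rescale, qBinomSeries,
      PowerSeries.coeff_mk]
    linear_combination c ^ (m + 1) * h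

/-- The product `F(b X) F(c X)` where `F` is the `q`-binomial series. -/
def seriesPair (q t : ℝ) (b c : ℂ) : PowerSeries ℂ :=
  PowerSeries.rescale b (qBinomSeries q t) * PowerSeries.rescale c (qBinomSeries q t)

lemma seriesPair_comm (q t : ℝ) (b c : ℂ) : seriesPair q t b c = seriesPair q t c b := mul_comm _ _

lemma coe_linPair (b c : ℂ) : ((linPair b c : Polynomial ℂ) : PowerSeries ℂ) =
    (1 - PowerSeries.C b * PowerSeries.X) * (1 - PowerSeries.C c * PowerSeries.X) := by
  simp [linPair]

lemma linPair_mul_seriesPair {q : ℝ} (hq0 : 0 < q) (hq1 : q < 1) (t : ℝ) (b c : ℂ) :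
    ((linPair b c : Polynomial ℂ) : PowerSeries ℂ) * seriesPair q t b c =
      ((linPair (t * b) (t * c) : Polynomial ℂ) : PowerSeries ℂ) *
        seriesPair q t (q * b) (q * c) := by
  simp only [coe_linPair, seriesPair]
  rw [mul_mul_mul_comm, rescale_qBinomSeries hq0 hq1, rescale_qBinomSeries hq0 hq1,
    mul_mul_mul_comm]

lemma linPair_mul_seriesPair_left {q : ℝ} (hq0 : 0 < q) (hq1 : q < 1) (t : ℝ) (b c : ℂ) :
    ((linPair b c : Polynomial ℂ) : PowerSeries ℂ) * seriesPair q t b (q * c) =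
      ((linPair (t * b) c : Polynomial ℂ) : PowerSeries ℂ) *
        seriesPair q t (q * b) (q * c) := by
  simp only [coe_linPair, seriesPair]
  rw [mul_mul_mul_comm, rescale_qBinomSeries hq0 hq1, mul_mul_mul_comm]

lemma linPair_ne_zero (b c : ℂ) : linPair b c ≠ 0 := by
  intro h
  have := linPair_eval b c 0
  simp [h] at this

/-- The eigenvalue equation in generating function form. -/
theorem sum_shiftCoeff_mul_series {n : ℕ} {q t : ℝ} (hq0 : 0 < q) (hq1 : q < 1) (ht : 0 < t)
    {y : Fin (n + 1) → ℂ} (hy : IsRegularPoint y) :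
    ∑ a : Fin (n + 1) → ℤˣ, PowerSeries.C (shiftCoeff t (signedPoint y a)) *
        ∏ i, seriesPair q t (q * signedPoint y a i) (signedPoint y a i)⁻¹ =
      PowerSeries.C (poincareProd t n) *
        (PowerSeries.C ((t : ℂ) ^ (n + 1)) * ∏ i, seriesPair q t (q * y i) (q * (y i)⁻¹) +
          ∏ i, seriesPair q t (y i) (y i)⁻¹) := by
  set D : PowerSeries ℂ := ((∏ i, linPair (y i) (y i)⁻¹ : Polynomial ℂ) : PowerSeries ℂ) with hD
  set H : PowerSeries ℂ := ∏ i, seriesPair q t (q * y i) (q * (y i)⁻¹) with hH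
  have hD0 : D ≠ 0 := by
    rw [hD, Ne, Polynomial.coe_eq_zero_iff]
    exact prod_ne_zero_iff.2 fun i _ => linPair_ne_zero _ _
  -- `D` and `H` are symmetric under `y_i ↦ y_i⁻¹`, so both may be rewritten in terms of `y_i^{a_i}`
  -- before the functional equation is applied to the factor with `(y_i^{a_i})⁻¹`.
  have hpair : ∀ a : Fin (n + 1) → ℤˣ,
      D * ∏ i, seriesPair q t (q * signedPoint y a i) (signedPoint y a i)⁻¹ =
        ((∏ i, linPair (t * (signedPoint y a i)⁻¹) (signedPoint y a i) : Polynomial ℂ) :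
          PowerSeries ℂ) * H := by
    intro a
    rw [hD, hH]
    simp only [← Polynomial.coeToPowerSeries.ringHom_apply, map_prod, ← prod_mul_distrib]
    refine prod_congr rfl fun i _ => ?_
    simp only [Polynomial.coeToPowerSeries.ringHom_apply]
    rw [← symm_zpow_unit linPair linPair_comm (y i) (a i),
      ← symm_zpow_unit (fun b c => seriesPair q t (q * b) (q * c))
        (fun b c => seriesPair_comm _ _ _ _) (y i) (a i), linPair_comm, seriesPair_comm,
      seriesPair_comm _ _ (q * y i ^ (a i : ℤ))]
    exact linPair_mul_seriesPair_left hq0 hq1 t _ _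
  have hG : D * ∏ i, seriesPair q t (y i) (y i)⁻¹ =
      ((∏ i, linPair (t * y i) (t * (y i)⁻¹) : Polynomial ℂ) : PowerSeries ℂ) * H := by
    rw [hD, hH]
    simp only [← Polynomial.coeToPowerSeries.ringHom_apply, map_prod, ← prod_mul_distrib]
    refine prod_congr rfl fun i _ => ?_
    exact linPair_mul_seriesPair hq0 hq1 t _ _
  have hpf := pfDiff_eq_zero ht hy
  rw [pfDiff, sub_eq_zero] at hpf
  have hpf := congrArg (fun p : Polynomial ℂ => (p : PowerSeries ℂ) * H) hpf
  simp only [← Polynomial.coeToPowerSeries.ringHom_apply, map_sum, map_mul, map_add] at hpf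
  simp only [Polynomial.coeToPowerSeries.ringHom_apply, Polynomial.coe_C] at hpf
  refine mul_left_cancel₀ hD0 ?_
  rw [mul_sum]
  calc _ = ∑ a : Fin (n + 1) → ℤˣ, PowerSeries.C (shiftCoeff t (signedPoint y a)) *
        ((∏ i, linPair (t * (signedPoint y a i)⁻¹) (signedPoint y a i) : Polynomial ℂ) :
          PowerSeries ℂ) * H := by
        refine sum_congr rfl fun a _ => ?_
        rw [mul_left_comm, hpair, mul_assoc]
    _ = _ := by
        rw [← sum_mul, hpf, mul_left_comm, mul_assoc, mul_add, hG]
        ring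

/-! ### The one-row polynomial as a coefficient, and its eigenvalue equation -/

/-- The exponent of a product of variables `y_k^{±1}`. -/
def signedExponent {n : ℕ} (j : Fin n × ℤˣ → ℕ) : Fin n → ℤ := fun k => j (k, 1) - j (k, -1)

/-- The identification of the `2n` variables `y_1, …, y_n, y_n⁻¹, …, y_1⁻¹` with pairs of an
index and a sign. -/
def signedIndex (n : ℕ) : Fin n × ℤˣ → Fin (2 * n) := fun x =>
  if x.2 = 1 then Fin.castLE (by omega) x.1 else Fin.rev (Fin.castLE (by omega) x.1)

lemma signedIndex_bijective (n : ℕ) : Function.Bijective (signedIndex n) := by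
  rw [Fintype.bijective_iff_injective_and_card]
  constructor
  · rintro ⟨i, a⟩ ⟨j, b⟩ h
    have hi := i.2
    have hj := j.2
    rcases Int.units_eq_one_or a with rfl | rfl <;> rcases Int.units_eq_one_or b with rfl | rfl <;>
      simp [signedIndex, Fin.ext_iff] at h ⊢ <;> omega
  · simp [mul_comm]

lemma rowFormula_eq (n l : ℕ) (q t : ℝ) : rowFormula n l q t =
    ((qBinomCoeff q t l)⁻¹ : ℂ) •
      ∑ j ∈ piAntidiag (univ : Finset (Fin n × ℤˣ)) l,
        (∏ k, (qBinomCoeff q t (j k) : ℂ)) • expWeight (signedExponent j) := by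
  unfold rowFormula
  congr 1
  · simp [qBinomCoeff]
  · let e := Equiv.ofBijective _ (signedIndex_bijective n)
    refine sum_equiv (Equiv.arrowCongr e.symm (Equiv.refl ℕ)) ?_ ?_
    · intro i
      simp only [mem_piAntidiag, mem_univ, implies_true, and_true]
      rw [← e.sum_comp]
      simp [Equiv.arrowCongr]
    · intro i _
      congr 1
      rw [← e.prod_comp]
      simp [qBinomCoeff, Equiv.arrowCongr]

/-- Evaluation at a point as a linear map. -/
def laurentEvalLin {n : ℕ} (y : Fin n → ℂ) : CnAlgebra n →ₗ[ℂ] ℂ where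
  toFun P := laurentEval P y
  map_add' P Q := by
    simp only [laurentEval, AddMonoidAlgebra.coeff_add]
    exact Finsupp.sum_add_index' (by simp) (by intros; ring)
  map_smul' c P := by
    simp only [laurentEval, AddMonoidAlgebra.coeff_smul, RingHom.id_apply, smul_eq_mul]
    rw [Finsupp.sum_smul_index' (by simp), Finsupp.mul_sum]
    simp [mul_assoc]

lemma laurentEvalLin_apply {n : ℕ} (y : Fin n → ℂ) (P : CnAlgebra n) :
    laurentEvalLin y P = laurentEval P y := rfl

lemma laurentEval_expWeight {n : ℕ} (ν : Fin n → ℤ) (y : Fin n → ℂ) :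
    laurentEval (expWeight ν) y = ∏ i, y i ^ ν i := by
  simp [laurentEval, expWeight]

lemma prod_units_int {M : Type*} [CommMonoid M] (f : ℤˣ → M) : ∏ e, f e = f 1 * f (-1) := by
  have : (univ : Finset ℤˣ) = {1, -1} := by decide
  rw [this, prod_pair (by decide)]

lemma sum_units_int {M : Type*} [AddCommMonoid M] (f : ℤˣ → M) : ∑ e, f e = f 1 + f (-1) := by
  have : (univ : Finset ℤˣ) = {1, -1} := by decide
  rw [this, sum_pair (by decide)]

lemma coeff_prod_rescale {ι : Type*} [Fintype ι] [DecidableEq ι] (q t : ℝ) (x : ι → ℂ) (l : ℕ) :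
    PowerSeries.coeff l (∏ k, PowerSeries.rescale (x k) (qBinomSeries q t)) =
      ∑ j ∈ piAntidiag (univ : Finset ι) l, (∏ k, (qBinomCoeff q t (j k) : ℂ)) * ∏ k, x k ^ j k := by
  rw [PowerSeries.coeff_prod]
  refine sum_equiv Finsupp.equivFunOnFinite ?_ ?_
  · intro j
    simp
  · intro j _
    rw [← prod_mul_distrib]
    refine prod_congr rfl fun k _ => ?_
    simp [PowerSeries.coeff_rescale, qBinomSeries, mul_comm]

lemma laurentEval_rowFormula {n : ℕ} (l : ℕ) (q t : ℝ) {y : Fin n → ℂ} (hy : ∀ i, y i ≠ 0) :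
    laurentEval (rowFormula n l q t) y =
      (qBinomCoeff q t l : ℂ)⁻¹ * PowerSeries.coeff l (∏ i, seriesPair q t (y i) (y i)⁻¹) := by
  have h : ∏ i, seriesPair q t (y i) (y i)⁻¹ =
      ∏ x : Fin n × ℤˣ, PowerSeries.rescale (y x.1 ^ (x.2 : ℤ)) (qBinomSeries q t) := by
    rw [Fintype.prod_prod_type]
    refine prod_congr rfl fun i _ => ?_
    rw [prod_units_int]
    simp [seriesPair]
  rw [h, coeff_prod_rescale, rowFormula_eq, ← laurentEvalLin_apply, map_smul, map_sum, smul_eq_mul]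
  congr 1
  refine sum_congr rfl fun j _ => ?_
  rw [map_smul, smul_eq_mul, laurentEvalLin_apply, laurentEval_expWeight,
    Fintype.prod_prod_type (fun x : Fin n × ℤˣ => (y x.1 ^ (x.2 : ℤ)) ^ j x)]
  congr 1
  refine prod_congr rfl fun i _ => ?_
  rw [prod_units_int, signedExponent, zpow_sub₀ (hy i)]
  simp [div_eq_mul_inv]

lemma rescale_seriesPair (q t : ℝ) (s b c : ℂ) :
    PowerSeries.rescale s (seriesPair q t b c) = seriesPair q t (b * s) (c * s) := by
  simp [seriesPair, PowerSeries.rescale_rescale]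

lemma macdonaldOp_eq {n : ℕ} (q t : ℝ) (f : (Fin n → ℂ) → ℂ) (y : Fin n → ℂ) :
    macdonaldOp q t f y =
      ∑ a : Fin n → ℤˣ, shiftCoeff t (signedPoint y a) * halfShift q a f y := by
  refine sum_congr rfl fun a _ => ?_
  simp only [shiftCoeff, signedPoint]
  congr 3
  funext i
  rw [mul_comm 2, zpow_mul, zpow_ofNat]

lemma macdonaldEigenvalue_rowPartition (n l : ℕ) (q t : ℝ) :
    (macdonaldEigenvalue q t (rowPartition (n + 1) l) : ℂ) =
      ((√q : ℝ) : ℂ)⁻¹ ^ l * (poincareProd t n * (1 + (t : ℂ) ^ (n + 1) * (q : ℂ) ^ l)) := by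
  have h1 : ∑ i, rowPartition (n + 1) l i = l := by
    rw [Fin.sum_univ_succ]
    simp [rowPartition]
  have h2 : ∏ i : Fin (n + 1), (1 + (t : ℂ) ^ ((i : ℕ) + 1) *
      (q : ℂ) ^ rowPartition (n + 1) l (Fin.rev i)) =
      poincareProd t n * (1 + (t : ℂ) ^ (n + 1) * (q : ℂ) ^ l) := by
    rw [Fin.prod_univ_castSucc, poincareProd, ← Fin.prod_univ_eq_prod_range]
    congr 1
    · refine prod_congr rfl fun i _ => ?_
      simp [rowPartition, Fin.rev_castSucc]
    · simp [rowPartition]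
  rw [macdonaldEigenvalue, h1]
  push_cast
  rw [h2]
  simp

theorem macdonaldOp_rowFormula (n l : ℕ) {q t : ℝ} (hq0 : 0 < q) (hq1 : q < 1) (ht : 0 < t)
    {y : Fin (n + 1) → ℂ} (hy : IsRegularPoint y) :
    macdonaldOp q t (laurentEval (rowFormula (n + 1) l q t)) y =
      (macdonaldEigenvalue q t (rowPartition (n + 1) l) : ℂ) *
        laurentEval (rowFormula (n + 1) l q t) y := by
  set s : ℂ := ((√q : ℝ) : ℂ) with hs
  have hs0 : s ≠ 0 := by
    rw [hs]
    exact_mod_cast (Real.sqrt_pos.2 hq0).ne'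
  have hss : s * s = q := by
    rw [hs]
    exact_mod_cast Real.mul_self_sqrt hq0.le
  -- The factor `s ^ l` is the effect of `X ↦ sX` on the coefficient of `X^l`; it turns the
  -- arguments `s z`, `s⁻¹ z⁻¹` into `q z`, `z⁻¹`.
  have hshift : ∀ a : Fin (n + 1) → ℤˣ,
      s ^ l * halfShift q a (laurentEval (rowFormula (n + 1) l q t)) y =
        (qBinomCoeff q t l : ℂ)⁻¹ * PowerSeries.coeff l
          (∏ i, seriesPair q t (q * signedPoint y a i) (signedPoint y a i)⁻¹) := by
    intro a
    rw [halfShift, laurentEval_rowFormula _ _ _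
      fun i => mul_ne_zero (zpow_ne_zero _ hs0) (hy.1 i), mul_left_comm]
    congr 1
    rw [← PowerSeries.coeff_rescale, map_prod]
    congr 1
    refine prod_congr rfl fun i _ => ?_
    -- Since `a i` is its own inverse, the shifted variable is `s z` up to inversion, which the
    -- symmetric pair does not see.
    have hz : s ^ (a i : ℤ) * y i = (s * signedPoint y a i) ^ (a i : ℤ) := by
      rw [signedPoint, mul_zpow, ← zpow_mul]
      simp [← Units.val_mul, Int.units_mul_self]
    rw [hz, symm_zpow_unit (seriesPair q t) (seriesPair_comm q t), rescale_seriesPair]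
    congr 1
    · rw [← hss]; ring
    · rw [mul_inv, mul_comm, mul_inv_cancel_left₀ hs0]
  have hH : PowerSeries.coeff l (∏ i, seriesPair q t (q * y i) (q * (y i)⁻¹)) =
      (q : ℂ) ^ l * PowerSeries.coeff l (∏ i, seriesPair q t (y i) (y i)⁻¹) := by
    rw [← PowerSeries.coeff_rescale, map_prod (PowerSeries.rescale _)]
    simp only [rescale_seriesPair, mul_comm]
  have hgen := congrArg (PowerSeries.coeff l) (sum_shiftCoeff_mul_series hq0 hq1 ht hy)
  simp only [map_sum, PowerSeries.coeff_C_mul, map_add, hH] at hgen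
  refine mul_left_cancel₀ (pow_ne_zero l hs0) ?_
  rw [macdonaldOp_eq, mul_sum]
  simp only [mul_left_comm (s ^ l), hshift]
  rw [macdonaldEigenvalue_rowPartition, laurentEval_rowFormula _ _ _ hy.1, ← hs]
  simp only [mul_left_comm _ (qBinomCoeff q t l : ℂ)⁻¹]
  rw [← mul_sum, hgen]
  have : s ^ l * s⁻¹ ^ l = 1 := by rw [← mul_pow, mul_inv_cancel₀ hs0, one_pow]
  linear_combination (-(qBinomCoeff q t l : ℂ)⁻¹ * poincareProd t n *
    (1 + (t : ℂ) ^ (n + 1) * (q : ℂ) ^ l) * PowerSeries.coeff l (∏ i, seriesPair q t (y i) (y i)⁻¹)) * this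

/-! ### Weyl group orbits and triangularity -/

lemma mem_weylOrbit {n : ℕ} {μ κ : Fin n → ℤ} : κ ∈ weylOrbit μ ↔ ∃ w, signedPerm w μ = κ := by
  simp [weylOrbit]

lemma signedPerm_signedPerm {n : ℕ} (w v : (Fin n → ℤˣ) × Equiv.Perm (Fin n)) (μ : Fin n → ℤ) :
    signedPerm w (signedPerm v μ) =
      signedPerm (fun i => w.1 i * v.1 (w.2 i), w.2.trans v.2) μ := by
  funext i
  simp [signedPerm, mul_assoc]

lemma signedPerm_inv {n : ℕ} (w : (Fin n → ℤˣ) × Equiv.Perm (Fin n)) (μ : Fin n → ℤ) :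
    signedPerm (fun i => w.1 (w.2.symm i), w.2.symm) (signedPerm w μ) = μ := by
  funext i
  simp [signedPerm, ← mul_assoc, Int.units_coe_mul_self]

lemma signedPerm_injective {n : ℕ} (w : (Fin n → ℤˣ) × Equiv.Perm (Fin n)) :
    Function.Injective (signedPerm w) := fun μ ν h => by
  rw [← signedPerm_inv w μ, h, signedPerm_inv]

lemma mem_weylOrbit_comm {n : ℕ} {μ κ : Fin n → ℤ} (h : κ ∈ weylOrbit μ) : μ ∈ weylOrbit κ := by
  obtain ⟨w, rfl⟩ := mem_weylOrbit.1 h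
  exact mem_weylOrbit.2 ⟨_, signedPerm_inv w μ⟩

lemma mem_weylOrbit_trans {n : ℕ} {μ κ ν : Fin n → ℤ} (h : κ ∈ weylOrbit μ)
    (h' : ν ∈ weylOrbit κ) : ν ∈ weylOrbit μ := by
  obtain ⟨w, rfl⟩ := mem_weylOrbit.1 h
  obtain ⟨v, rfl⟩ := mem_weylOrbit.1 h'
  exact mem_weylOrbit.2 ⟨_, (signedPerm_signedPerm v w μ).symm⟩

/-- The representative is obtained by sorting the absolute values in decreasing order. -/
lemma exists_partition_mem_weylOrbit {n : ℕ} (κ : Fin n → ℤ) :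
    ∃ μ, IsPartition μ ∧ κ ∈ weylOrbit μ := by
  let σ := Tuple.sort fun i => -|κ i|
  let w : (Fin n → ℤˣ) × Equiv.Perm (Fin n) := (fun i => if κ (σ i) < 0 then -1 else 1, σ)
  have hw : signedPerm w κ = fun i => |κ (σ i)| := by
    funext i
    by_cases h : κ (σ i) < 0
    · simp [signedPerm, w, h, abs_of_neg h]
    · simp [signedPerm, w, h, abs_of_nonneg (not_lt.1 h)]
  refine ⟨signedPerm w κ, ⟨?_, ?_⟩, mem_weylOrbit_comm (mem_weylOrbit.2 ⟨w, rfl⟩)⟩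
  · rw [hw]
    intro i j hij
    have := Tuple.monotone_sort (fun i => -|κ i|) hij
    simpa using this
  · rw [hw]
    exact fun i => abs_nonneg _

lemma IsPartition.eq_of_mem_weylOrbit {n : ℕ} {μ ν : Fin n → ℤ} (hμ : IsPartition μ)
    (hν : IsPartition ν) (h : ν ∈ weylOrbit μ) : ν = μ := by
  obtain ⟨w, rfl⟩ := mem_weylOrbit.1 h
  have hw : signedPerm w μ = μ ∘ w.2 := by
    funext i
    have h1 := hν.2 i
    have h2 := hμ.2 (w.2 i)
    simp only [signedPerm, Function.comp] at h1 ⊢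
    rcases Int.units_eq_one_or (w.1 i) with h | h <;> simp [h] at h1 ⊢
    omega
  rw [hw]
  exact Tuple.unique_antitone (σ := w.2) (τ := 1) (hw ▸ hν.1) hμ.1

lemma orbitSum_coeff {n : ℕ} (μ κ : Fin n → ℤ) :
    (orbitSum μ).coeff κ = if κ ∈ weylOrbit μ then 1 else 0 := by
  simp [orbitSum, expWeight, Finsupp.single_apply]

/-- An orbit contains only one partition, so a single orbit sum contributes to the coefficient of
`κ`. -/
lemma coeff_sum_orbitSum {n : ℕ} {a : (Fin n → ℤ) →₀ ℂ} (ha : ∀ ν ∈ a.support, IsPartition ν)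
    {κ μ : Fin n → ℤ} (hμ : IsPartition μ) (hκ : κ ∈ weylOrbit μ) :
    (a.sum fun ν c => c • orbitSum ν).coeff κ = a μ := by
  rw [Finsupp.sum, AddMonoidAlgebra.coeff_sum, Finsupp.finsetSum_apply]
  simp only [AddMonoidAlgebra.coeff_smul, Finsupp.smul_apply, orbitSum_coeff, smul_eq_mul]
  rw [sum_eq_single μ]
  · simp [hκ]
  · intro ν hν hne
    rw [if_neg, mul_zero]
    intro h
    exact hne ((ha ν hν).eq_of_mem_weylOrbit hμ (mem_weylOrbit_trans h (mem_weylOrbit_comm hκ))).symm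
  · intro h
    simp [Finsupp.notMem_support_iff.1 h]

/-- The coefficients of a Laurent polynomial are constant on Weyl group orbits. -/
def IsWeylInvariant {n : ℕ} (P : CnAlgebra n) : Prop :=
  ∀ w κ, P.coeff (signedPerm w κ) = P.coeff κ

lemma isWeylInvariant_sum_orbitSum {n : ℕ} {a : (Fin n → ℤ) →₀ ℂ}
    (ha : ∀ ν ∈ a.support, IsPartition ν) :
    IsWeylInvariant (a.sum fun ν c => c • orbitSum ν) := by
  intro w κ
  obtain ⟨μ, hμ, hκ⟩ := exists_partition_mem_weylOrbit κ
  rw [coeff_sum_orbitSum ha hμ hκ,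
    coeff_sum_orbitSum ha hμ (mem_weylOrbit_trans hκ (mem_weylOrbit.2 ⟨w, rfl⟩))]

lemma IsWeylInvariant.eq_sum_orbitSum {n : ℕ} {P : CnAlgebra n} (hP : IsWeylInvariant P) :
    ∃ a : (Fin n → ℤ) →₀ ℂ, (∀ ν ∈ a.support, IsPartition ν ∧ P.coeff ν ≠ 0) ∧
      (∀ ν, IsPartition ν → a ν = P.coeff ν) ∧ P = a.sum fun ν c => c • orbitSum ν := by
  classical
  have ha : ∀ ν ∈ (P.coeff.filter IsPartition).support, IsPartition ν ∧ P.coeff ν ≠ 0 := by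
    intro ν hν
    rw [Finsupp.support_filter, mem_filter, Finsupp.mem_support_iff] at hν
    exact ⟨hν.2, hν.1⟩
  refine ⟨P.coeff.filter IsPartition, ha, fun ν hν => Finsupp.filter_apply_pos _ _ hν, ?_⟩
  ext κ
  obtain ⟨μ, hμ, hκ⟩ := exists_partition_mem_weylOrbit κ
  rw [coeff_sum_orbitSum (fun ν hν => (ha ν hν).1) hμ hκ, Finsupp.filter_apply_pos _ _ hμ]
  obtain ⟨w, rfl⟩ := mem_weylOrbit.1 hκ
  exact hP w μ

lemma rowFormula_coeff (n l : ℕ) (q t : ℝ) (κ : Fin n → ℤ) : (rowFormula n l q t).coeff κ =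
    (qBinomCoeff q t l : ℂ)⁻¹ * ∑ j ∈ piAntidiag (univ : Finset (Fin n × ℤˣ)) l,
      if signedExponent j = κ then (∏ k, (qBinomCoeff q t (j k) : ℂ)) else 0 := by
  rw [rowFormula_eq, AddMonoidAlgebra.coeff_smul, AddMonoidAlgebra.coeff_sum, Finsupp.smul_apply,
    Finsupp.finsetSum_apply, smul_eq_mul]
  simp [expWeight, Finsupp.single_apply]

/-- The action of a signed permutation on the variables `y_k^{±1}`. -/
def signedPermIndex {n : ℕ} (w : (Fin n → ℤˣ) × Equiv.Perm (Fin n)) :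
    Fin n × ℤˣ ≃ Fin n × ℤˣ where
  toFun x := (w.2 x.1, w.1 x.1 * x.2)
  invFun x := (w.2.symm x.1, w.1 (w.2.symm x.1) * x.2)
  left_inv x := by simp [← mul_assoc, Int.units_mul_self]
  right_inv x := by simp [← mul_assoc, Int.units_mul_self]

lemma signedExponent_comp {n : ℕ} (w : (Fin n → ℤˣ) × Equiv.Perm (Fin n)) (j : Fin n × ℤˣ → ℕ) :
    signedExponent (j ∘ signedPermIndex w) = signedPerm w (signedExponent j) := by
  funext k
  simp only [signedExponent, signedPerm, signedPermIndex, Function.comp, Equiv.coe_fn_mk]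
  rcases Int.units_eq_one_or (w.1 k) with h | h <;> simp [h]

lemma isWeylInvariant_rowFormula (n l : ℕ) (q t : ℝ) : IsWeylInvariant (rowFormula n l q t) := by
  intro w κ
  rw [rowFormula_coeff, rowFormula_coeff]
  congr 1
  symm
  refine sum_equiv (Equiv.arrowCongr (signedPermIndex w).symm (Equiv.refl ℕ)) ?_ ?_
  · intro j
    simp only [mem_piAntidiag, mem_univ, implies_true, and_true]
    rw [← (signedPermIndex w).sum_comp]
    simp [Equiv.arrowCongr]
  · intro j _
    have : Equiv.arrowCongr (signedPermIndex w).symm (Equiv.refl ℕ) j = j ∘ signedPermIndex w := by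
      funext; simp [Equiv.arrowCongr]
    rw [this, signedExponent_comp]
    simp only [(signedPerm_injective w).eq_iff]
    congr 1
    exact ((signedPermIndex w).prod_comp fun k => (qBinomCoeff q t (j k) : ℂ)).symm

/-- The witness counts the inverse variables in a contributing monomial: replacing `y_k` by `y_k⁻¹`
lowers the coordinate sum by two. -/
lemma sum_of_rowFormula_coeff_ne_zero {n l : ℕ} {q t : ℝ} {κ : Fin n → ℤ}
    (h : (rowFormula n l q t).coeff κ ≠ 0) : ∃ m : ℕ, (l : ℤ) - ∑ i, κ i = m * 2 := by
  rw [rowFormula_coeff] at h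
  obtain ⟨j, hj, hne⟩ := exists_ne_zero_of_sum_ne_zero (right_ne_zero_of_mul h)
  have hκ : signedExponent j = κ := by
    by_contra hc
    simp [hc] at hne
  have hl := (mem_piAntidiag.1 hj).1
  rw [Fintype.sum_prod_type] at hl
  simp only [sum_units_int, sum_add_distrib] at hl
  refine ⟨∑ k, j (k, -1), ?_⟩
  rw [← hκ, ← hl]
  simp only [signedExponent, sum_sub_distrib]
  push_cast
  ring

lemma qBinomCoeff_zero (q t : ℝ) : qBinomCoeff q t 0 = 1 := by simp [qBinomCoeff, qShifted]

lemma rowFormula_coeff_rowPartition {n l : ℕ} {q t : ℝ} (h : qBinomCoeff q t l ≠ 0) :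
    (rowFormula (n + 1) l q t).coeff (rowPartition (n + 1) l) = 1 := by
  rw [rowFormula_coeff, sum_eq_single (Pi.single (0, 1) l)]
  · rw [if_pos, Fintype.prod_eq_single (0, 1)]
    · rw [Pi.single_eq_same, inv_mul_cancel₀ (by exact_mod_cast h)]
    · intro k hk
      rw [Pi.single_eq_of_ne hk, qBinomCoeff_zero, Complex.ofReal_one]
    · funext k
      by_cases hk : k = 0
      · subst hk
        simp [signedExponent, rowPartition]
      · have : (k : ℕ) ≠ 0 := fun h => hk (Fin.ext h)
        simp [signedExponent, rowPartition, hk, this]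
  · intro j hj hne
    refine if_neg fun hc => hne ?_
    have hl := (mem_piAntidiag.1 hj).1
    rw [← add_sum_erase _ _ (mem_univ ((0 : Fin (n + 1)), (1 : ℤˣ)))] at hl
    have h0 := congrFun hc 0
    simp only [signedExponent, rowPartition, Fin.val_zero, if_true] at h0
    -- The exponent `l` of the first variable gives `j (0, 1) ≥ l`, while all entries of `j` sum to
    -- `l`; nothing is left for the others.
    have hsum : ∑ x ∈ univ.erase ((0 : Fin (n + 1)), (1 : ℤˣ)), j x = 0 := by omega
    funext x
    by_cases hx : x = (0, 1)
    · subst hx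
      rw [Pi.single_eq_same]
      omega
    · rw [Pi.single_eq_of_ne hx]
      exact (sum_eq_zero_iff.1 hsum) x (mem_erase.2 ⟨hx, mem_univ _⟩)
  · intro hc
    simp [mem_piAntidiag] at hc

lemma rowPartition_sub_mem_positiveCone {n l m : ℕ} {ν : Fin (n + 1) → ℤ} (hν : IsPartition ν)
    (h : (l : ℤ) - ∑ i, ν i = m * 2) : rowPartition (n + 1) l - ν ∈ positiveCone (n + 1) := by
  -- Each lower row is moved to the first by roots `ε_1 - ε_i`; the missing even number of boxes is
  -- supplied by `2 ε_1`.
  have heq : rowPartition (n + 1) l - ν = m • (Pi.single 0 2 : Fin (n + 1) → ℤ) +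
      ∑ i : Fin n, (ν i.succ).toNat •
        (Pi.single 0 1 - Pi.single i.succ 1 : Fin (n + 1) → ℤ) := by
    rw [Fin.sum_univ_succ] at h
    funext k
    simp only [Pi.add_apply, Pi.sub_apply, Finset.sum_apply, nsmul_eq_mul]
    refine Fin.cases ?_ (fun k => ?_) k
    · simp [rowPartition, hν.2]
      omega
    · simp [rowPartition, Pi.single_apply, Fin.ext_iff, hν.2]
      simp [← Fin.ext_iff]
  have hroot : ∀ α ∈ positiveRoots (n + 1), α ∈ positiveCone (n + 1) := fun α hα =>
    AddSubmonoid.subset_closure hα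
  rw [heq]
  refine add_mem (nsmul_mem (hroot _ (Or.inr ⟨0, rfl⟩)) _)
    (sum_mem fun i _ => nsmul_mem (hroot _ (Or.inl ?_)) _)
  exact ⟨0, i.succ, Fin.succ_pos i, Or.inl rfl⟩

lemma isPartition_rowPartition (n l : ℕ) : IsPartition (rowPartition n l) := by
  constructor
  · intro i j hij
    simp only [rowPartition]
    have := Fin.le_def.1 hij
    split_ifs <;> omega
  · intro i
    simp only [rowPartition]
    split_ifs <;> omega

theorem rowFormula_isMacdonaldPolynomial (n l : ℕ) {q t : ℝ} (hq0 : 0 < q) (hq1 : q < 1)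
    (ht : 0 < t) (htl : qShifted q t l ≠ 0) :
    IsMacdonaldPolynomial q t (rowPartition (n + 1) l) (rowFormula (n + 1) l q t) := by
  refine ⟨?_, fun y hy => macdonaldOp_rowFormula n l hq0 hq1 ht hy⟩
  obtain ⟨a, ha, haP, hsum⟩ := (isWeylInvariant_rowFormula (n + 1) l q t).eq_sum_orbitSum
  have h1 : a (rowPartition (n + 1) l) = 1 := by
    rw [haP _ (isPartition_rowPartition _ _),
      rowFormula_coeff_rowPartition (div_ne_zero htl (qShifted_self_ne_zero hq0 hq1 l))]
  refine ⟨a.erase (rowPartition (n + 1) l), ?_, ?_⟩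
  · intro ν hν
    rw [Finsupp.support_erase, mem_erase] at hν
    obtain ⟨hpart, hne⟩ := ha ν hν.2
    obtain ⟨m, hm⟩ := sum_of_rowFormula_coeff_ne_zero hne
    exact ⟨hpart, rowPartition_sub_mem_positiveCone hpart hm, hν.1⟩
  · rw [hsum, ← Finsupp.add_sum_erase a (rowPartition (n + 1) l) _ (by simp [h1]), h1, one_smul]

/-! ### Comparison of eigenvalues for `t < 1` -/

lemma zpow_finset_sum {K ι : Type*} [Field K] {x : K} (hx : x ≠ 0) (s : Finset ι) (f : ι → ℤ) :
    x ^ (∑ i ∈ s, f i) = ∏ i ∈ s, x ^ f i := by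
  classical
  induction s using Finset.induction_on with
  | empty => simp
  | insert i s hi ih => rw [sum_insert hi, prod_insert hi, zpow_add₀ hx, ih]

/-- The factor of the eigenvalue attached to one coordinate. -/
def eigenFactor (s t : ℝ) (r : ℕ) (a : ℤ) : ℝ := s ^ (-a) + t ^ r * s ^ a

lemma macdonaldEigenvalue_eq {n : ℕ} {q : ℝ} (hq0 : 0 < q) (t : ℝ) (μ : Fin n → ℤ) :
    macdonaldEigenvalue q t μ = ∏ i : Fin n, eigenFactor (√q) t (n - i) (μ i) := by
  have hs : √q ≠ 0 := (Real.sqrt_pos.2 hq0).ne'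
  have hq : q = √q * √q := (Real.mul_self_sqrt hq0.le).symm
  rw [macdonaldEigenvalue, ← sum_neg_distrib, zpow_finset_sum hs, ← Equiv.prod_comp Fin.revPerm,
    ← prod_mul_distrib]
  conv_rhs => rw [← Equiv.prod_comp Fin.revPerm]
  refine prod_congr rfl fun i _ => ?_
  have hi : n - (Fin.rev i : ℕ) = i + 1 := by
    rw [Fin.val_rev]
    omega
  rw [Fin.revPerm_apply, eigenFactor, hi]
  nth_rw 2 [hq]
  rw [mul_zpow, mul_add, mul_one, zpow_neg]
  have := zpow_ne_zero (μ (Fin.rev i)) hs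
  field_simp

lemma eigenFactor_pos {s t : ℝ} (hs : 0 < s) (ht : 0 < t) (r : ℕ) (a : ℤ) :
    0 < eigenFactor s t r a := by
  unfold eigenFactor
  positivity

/-- The difference factors as `(s^a - s^b) ((s^a s^b)⁻¹ - t^r)`, with both factors positive. -/
lemma eigenFactor_lt {s t : ℝ} (hs0 : 0 < s) (hs1 : s < 1) (ht0 : 0 < t) (ht1 : t < 1) {r : ℕ}
    (hr : r ≠ 0) {a b : ℤ} (ha : 0 ≤ a) (hab : a < b) :
    eigenFactor s t r a < eigenFactor s t r b := by
  have h1 : s ^ b < s ^ a := zpow_lt_zpow_right_of_lt_one₀ hs0 hs1 hab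
  have h2 : s ^ a * s ^ b ≤ 1 := by
    rw [← zpow_add₀ hs0.ne']
    exact zpow_le_one₀ hs0 hs1.le (by omega)
  have h3 : t ^ r < 1 := pow_lt_one₀ ht0.le ht1 hr
  have hA : 0 < s ^ a := zpow_pos hs0 a
  have hB : 0 < s ^ b := zpow_pos hs0 b
  have h4 : 1 ≤ (s ^ a * s ^ b)⁻¹ := (one_le_inv₀ (by positivity)).2 h2
  have h5 : 0 < (s ^ a - s ^ b) * ((s ^ a * s ^ b)⁻¹ - t ^ r) :=
    mul_pos (sub_pos.2 h1) (sub_pos.2 (h3.trans_le h4))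
  have h6 : (s ^ a - s ^ b) * (s ^ a * s ^ b)⁻¹ = (s ^ b)⁻¹ - (s ^ a)⁻¹ := by
    field_simp
  unfold eigenFactor
  rw [zpow_neg, zpow_neg]
  linarith [mul_sub (s ^ a - s ^ b) (s ^ a * s ^ b)⁻¹ (t ^ r), sub_mul (s ^ a) (s ^ b) (t ^ r)]

/-- Moving `b` boxes from a lower row, which carries the smaller power of `t`, to a higher one. The
gain factors as in `hdiff`, and `k < r` makes its second factor positive. -/
lemma eigenFactor_merge {s t : ℝ} (hs0 : 0 < s) (hs1 : s < 1) (ht0 : 0 < t) (ht1 : t < 1)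
    {r k : ℕ} (hr : k < r) {a b : ℤ} (ha : 0 ≤ a) (hb : 0 ≤ b) :
    eigenFactor s t r a * eigenFactor s t k b ≤ eigenFactor s t r (a + b) * eigenFactor s t k 0 ∧
    (0 < b → eigenFactor s t r a * eigenFactor s t k b <
      eigenFactor s t r (a + b) * eigenFactor s t k 0) := by
  have hdiff : eigenFactor s t r (a + b) * eigenFactor s t k 0 -
      eigenFactor s t r a * eigenFactor s t k b =
      (s ^ (-b) - s ^ b) * (t ^ k * s ^ (-a) - t ^ r * s ^ a) := by
    simp only [eigenFactor, neg_add, zpow_add₀ hs0.ne', neg_zero, zpow_zero]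
    ring
  have h2 : 0 < t ^ k * s ^ (-a) - t ^ r * s ^ a := by
    have h3 : t ^ r < t ^ k := pow_lt_pow_right_of_lt_one₀ ht0 ht1 hr
    have h4 : s ^ a ≤ s ^ (-a) := zpow_le_zpow_right_of_le_one₀ hs0 hs1.le (by omega)
    have h5 : t ^ r * s ^ a < t ^ k * s ^ a := mul_lt_mul_of_pos_right h3 (zpow_pos hs0 a)
    have h6 : t ^ k * s ^ a ≤ t ^ k * s ^ (-a) := mul_le_mul_of_nonneg_left h4 (pow_nonneg ht0.le k)
    linarith
  constructor
  · have h1 : 0 ≤ s ^ (-b) - s ^ b :=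
      sub_nonneg.2 (zpow_le_zpow_right_of_le_one₀ hs0 hs1.le (by omega))
    linarith [mul_nonneg h1 h2.le]
  · intro hb
    have h1 : 0 < s ^ (-b) - s ^ b :=
      sub_pos.2 (zpow_lt_zpow_right_of_lt_one₀ hs0 hs1 (by omega))
    linarith [mul_pos h1 h2]

lemma prod_eigenFactor_merge {ι : Type*} {s t : ℝ} (hs0 : 0 < s) (hs1 : s < 1) (ht0 : 0 < t)
    (ht1 : t < 1) {r : ℕ} {k : ι → ℕ} (hr : ∀ i, k i < r) {a : ℤ} {b : ι → ℤ} (ha : 0 ≤ a)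
    (hb : ∀ i, 0 ≤ b i) (S : Finset ι) :
    eigenFactor s t r a * ∏ i ∈ S, eigenFactor s t (k i) (b i) ≤
      eigenFactor s t r (a + ∑ i ∈ S, b i) * ∏ i ∈ S, eigenFactor s t (k i) 0 ∧
    ((∃ i ∈ S, 0 < b i) → eigenFactor s t r a * ∏ i ∈ S, eigenFactor s t (k i) (b i) <
      eigenFactor s t r (a + ∑ i ∈ S, b i) * ∏ i ∈ S, eigenFactor s t (k i) 0) := by
  classical
  induction S using Finset.induction_on with
  | empty => simp
  | insert i S hi ih =>
    have hsum : 0 ≤ a + ∑ i ∈ S, b i := add_nonneg ha (sum_nonneg fun i _ => hb i)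
    obtain ⟨m1, m2⟩ := eigenFactor_merge hs0 hs1 ht0 ht1 (hr i) hsum (hb i)
    have hp : 0 < ∏ i ∈ S, eigenFactor s t (k i) 0 :=
      prod_pos fun i _ => eigenFactor_pos hs0 ht0 _ _
    have hpi := eigenFactor_pos hs0 ht0 (k i) (b i)
    rw [prod_insert hi, prod_insert hi, sum_insert hi, add_comm (b i), ← add_assoc]
    have e1 := mul_le_mul_of_nonneg_left ih.1 hpi.le
    have e2 := mul_le_mul_of_nonneg_right m1 hp.le
    refine ⟨by linarith, ?_⟩
    rintro ⟨j, hj, hbj⟩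
    rcases mem_insert.1 hj with rfl | hj
    · have e3 := mul_lt_mul_of_pos_right (m2 hbj) hp
      linarith
    · have e3 := mul_lt_mul_of_pos_left (ih.2 ⟨j, hj, hbj⟩) hpi
      linarith

lemma sum_nonneg_of_mem_positiveCone {n : ℕ} {α : Fin n → ℤ} (h : α ∈ positiveCone n) :
    0 ≤ ∑ i, α i := by
  induction h using AddSubmonoid.closure_induction with
  | mem α h =>
    rcases h with ⟨i, j, _, rfl | rfl⟩ | ⟨i, rfl⟩ <;> simp [sum_add_distrib]
  | zero => simp
  | add α β _ _ h1 h2 =>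
    simp only [Pi.add_apply, sum_add_distrib]
    exact add_nonneg h1 h2

/-- For `t < 1` the eigenvalue of a one-row partition exceeds those of all smaller partitions. -/
theorem macdonaldEigenvalue_lt {n l : ℕ} {q t : ℝ} (hq0 : 0 < q) (hq1 : q < 1) (ht0 : 0 < t)
    (ht1 : t < 1) {ν : Fin (n + 1) → ℤ} (hν : IsPartition ν)
    (hlt : WeightLT ν (rowPartition (n + 1) l)) :
    macdonaldEigenvalue q t ν < macdonaldEigenvalue q t (rowPartition (n + 1) l) := by
  have hs0 : 0 < √q := Real.sqrt_pos.2 hq0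
  have hs1 : √q < 1 := by
    rw [Real.sqrt_lt' one_pos]
    simpa using hq1
  have hsum := sum_nonneg_of_mem_positiveCone hlt.1
  have hle : ν 0 + ∑ i : Fin n, ν i.succ ≤ l := by
    simp only [Fin.sum_univ_succ, Pi.sub_apply] at hsum
    simp [rowPartition] at hsum
    linarith
  rw [macdonaldEigenvalue_eq hq0, macdonaldEigenvalue_eq hq0, Fin.prod_univ_succ,
    Fin.prod_univ_succ]
  have hrow : ∀ i : Fin n, rowPartition (n + 1) l i.succ = 0 := fun i => by simp [rowPartition]
  have hrow0 : rowPartition (n + 1) l 0 = l := by simp [rowPartition]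
  simp only [hrow, hrow0]
  have hS : 0 ≤ ∑ i : Fin n, ν i.succ := sum_nonneg fun i _ => hν.2 _
  have hr0 : n + 1 - ((0 : Fin (n + 1)) : ℕ) ≠ 0 := by simp
  have hp : 0 < ∏ i : Fin n, eigenFactor (√q) t (n + 1 - (i.succ : Fin (n + 1))) 0 :=
    prod_pos fun i _ => eigenFactor_pos hs0 ht0 _ _
  obtain ⟨m1, m2⟩ := prod_eigenFactor_merge hs0 hs1 ht0 ht1
    (r := n + 1 - ((0 : Fin (n + 1)) : ℕ)) (k := fun i : Fin n => n + 1 - (i.succ : Fin (n + 1)))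
    (fun i => by simp) (hν.2 0) (fun i : Fin n => hν.2 i.succ) univ
  -- With a nonempty lower row, merging is already strict. Otherwise strictness must come from a
  -- first row shorter than `l`, which `ν ≠ (l, 0, …, 0)` guarantees.
  by_cases h : ∃ i : Fin n, 0 < ν i.succ
  · obtain ⟨i, hi⟩ := h
    refine (m2 ⟨i, mem_univ _, hi⟩).trans_le (mul_le_mul_of_nonneg_right ?_ hp.le)
    rcases hle.eq_or_lt with h | h
    · rw [h]
    · exact (eigenFactor_lt hs0 hs1 ht0 ht1 hr0 (add_nonneg (hν.2 0) hS) h).le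
  · push Not at h
    have hz : ∀ i : Fin n, ν i.succ = 0 := fun i => le_antisymm (h i) (hν.2 _)
    simp only [hz, sum_const_zero, add_zero] at m1 hle ⊢
    refine mul_lt_mul_of_pos_right (eigenFactor_lt hs0 hs1 ht0 ht1 hr0 (hν.2 0) ?_) hp
    refine lt_of_le_of_ne hle fun h0 => hlt.2 ?_
    funext i
    refine Fin.cases ?_ (fun i => ?_) i
    · rw [h0, hrow0]
    · rw [hz, hrow]

/-! ### Leading terms at infinity and uniqueness -/

/-- A strictly dominant weight that separates a given finite set of weights. -/
lemma exists_separating_weight {n : ℕ} (S : Finset (Fin n → ℤ)) :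
    ∃ N : Fin n → ℤ, (∀ i, 0 < N i) ∧ StrictAnti N ∧
      Set.InjOn (fun κ : Fin n → ℤ => ∑ i, κ i * N i) S := by
  classical
  -- The weight is sought as `N_i = M^(n-1-i)` with zero-based `i`. Two weights have the same
  -- pairing with `N` exactly when `M` is a root of `p` of their difference, so finitely many `M`
  -- are excluded; `M ≥ 2` makes `N` strictly decreasing.
  let p : (Fin n → ℤ) → Polynomial ℤ := fun d =>
    ∑ i, Polynomial.C (d i) * Polynomial.X ^ (Fin.rev i : ℕ)
  have hcoeff : ∀ d i, (p d).coeff (Fin.rev i : ℕ) = d i := by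
    intro d i
    simp only [p, Polynomial.finsetSum_coeff, Polynomial.coeff_C_mul_X_pow]
    rw [sum_eq_single i]
    · simp
    · intro j _ hj
      rw [if_neg]
      intro h
      exact hj (Fin.rev_injective (Fin.ext h)).symm
    · simp
  have hp : ∏ x ∈ S.offDiag, p (x.1 - x.2) ≠ 0 := by
    refine prod_ne_zero_iff.2 fun x hx h => (mem_offDiag.1 hx).2.2 ?_
    funext i
    have := hcoeff (x.1 - x.2) i
    rw [h, Polynomial.coeff_zero, Pi.sub_apply] at this
    linarith
  obtain ⟨M, hM, hroot⟩ := (Set.Ici_infinite (2 : ℤ)).exists_notMem_finset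
    (∏ x ∈ S.offDiag, p (x.1 - x.2)).roots.toFinset
  have hM : 2 ≤ M := hM
  refine ⟨fun i => M ^ (Fin.rev i : ℕ), fun i => by positivity, fun i j hij => ?_, ?_⟩
  · exact pow_lt_pow_right₀ (by omega) (Fin.lt_def.1 (Fin.rev_lt_rev.2 hij))
  · intro κ hκ κ' hκ' h
    by_contra hne
    refine hroot ?_
    rw [Multiset.mem_toFinset, Polynomial.mem_roots hp, Polynomial.IsRoot, Polynomial.eval_prod]
    refine prod_eq_zero (mem_offDiag.2 ⟨hκ, hκ', hne⟩ : (κ, κ') ∈ S.offDiag) ?_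
    simp only [p, Polynomial.eval_finsetSum, Polynomial.eval_mul, Polynomial.eval_C,
      Polynomial.eval_pow, Polynomial.eval_X, Pi.sub_apply, sub_mul, sum_sub_distrib]
    exact sub_eq_zero.2 h

lemma tendsto_ofReal_zpow_zero {k : ℤ} (hk : k < 0) :
    Tendsto (fun x : ℝ => (x : ℂ) ^ k) atTop (𝓝 0) := by
  have h := (Complex.continuous_ofReal.tendsto 0).comp (tendsto_zpow_atTop_zero (𝕜 := ℝ) hk)
  simpa [Function.comp_def] using h

lemma tendsto_factor (t : ℂ) {k : ℤ} (hk : k ≠ 0) :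
    Tendsto (fun x : ℝ => (1 - t * (x : ℂ) ^ k) / (1 - (x : ℂ) ^ k)) atTop
      (𝓝 (if 0 < k then t else 1)) := by
  rcases lt_or_gt_of_ne hk with h | h
  · rw [if_neg h.not_gt]
    have h0 := tendsto_ofReal_zpow_zero h
    have := ((h0.const_mul t).const_sub 1).div (h0.const_sub 1) (by simp)
    simpa [Pi.div_def] using this
  · rw [if_pos h]
    have h0 := tendsto_ofReal_zpow_zero (neg_lt_zero.2 h)
    have := (h0.sub_const t).div (h0.sub_const 1) (by simp)
    simp only [zero_sub, neg_div_neg_eq, div_one] at this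
    refine this.congr' ?_
    filter_upwards [eventually_gt_atTop 0] with x hx
    have hx0 : (x : ℂ) ^ k ≠ 0 := zpow_ne_zero _ (by exact_mod_cast hx.ne')
    simp only [Pi.div_apply]
    rw [zpow_neg, ← mul_div_mul_left _ _ hx0]
    congr 1 <;> field_simp

/-- As `N` is positive and strictly decreasing, for `i < j` the sign of `a_i N_i + a_j N_j` is that
of `a_i`. When `a_i = 1`, the index `i` therefore yields one factor `t` for each `j > i` and one
more for `2 ε_i`, in all `t^(n-i)` with zero-based `i`. -/
lemma tendsto_shiftCoeff {n : ℕ} (t : ℂ) {N : Fin n → ℤ} (hN0 : ∀ i, 0 < N i) (hN : StrictAnti N)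
    (a : Fin n → ℤˣ) :
    Tendsto (fun x : ℝ => shiftCoeff t (signedPoint (fun i => (x : ℂ) ^ N i) a)) atTop
      (𝓝 (∏ i : Fin n, if a i = 1 then t ^ (n - i : ℕ) else 1)) := by
  have hpair : ∀ i j, i < j → (a i * N i + a j * N j ≠ 0) ∧
      (0 < a i * N i + a j * N j ↔ a i = 1) := by
    intro i j hij
    have h1 := hN hij
    have h2 := hN0 j
    rcases Int.units_eq_one_or (a i) with h | h <;> rcases Int.units_eq_one_or (a j) with h' | h' <;>
      simp [h, h'] <;> omega
  have hsing : ∀ i, (2 * (a i * N i) ≠ 0) ∧ (0 < 2 * (a i * N i) ↔ a i = 1) := by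
    intro i
    have h2 := hN0 i
    rcases Int.units_eq_one_or (a i) with h | h <;> simp [h] <;> omega
  have hlim : Tendsto (fun x : ℝ =>
      (∏ i, ∏ j ∈ Ioi i, (1 - t * (x : ℂ) ^ (a i * N i + a j * N j)) /
        (1 - (x : ℂ) ^ (a i * N i + a j * N j))) *
      ∏ i, (1 - t * (x : ℂ) ^ (2 * (a i * N i))) / (1 - (x : ℂ) ^ (2 * (a i * N i)))) atTop
      (𝓝 ((∏ i : Fin n, ∏ j ∈ Ioi i, if 0 < a i * N i + a j * N j then t else 1) *
        ∏ i, if 0 < 2 * (a i * N i) then t else 1)) :=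
    (tendsto_finsetProd _ fun i _ => tendsto_finsetProd _ fun j hj =>
      tendsto_factor t (hpair i j (mem_Ioi.1 hj)).1).mul
      (tendsto_finsetProd _ fun i _ => tendsto_factor t (hsing i).1)
  have hval : (∏ i : Fin n, ∏ j ∈ Ioi i, if 0 < a i * N i + a j * N j then t else 1) *
        (∏ i, if 0 < 2 * (a i * N i) then t else 1) =
      ∏ i : Fin n, if a i = 1 then t ^ (n - i : ℕ) else 1 := by
    rw [← prod_mul_distrib]
    refine prod_congr rfl fun i _ => ?_
    rw [prod_congr rfl fun j hj => if_congr (hpair i j (mem_Ioi.1 hj)).2 rfl rfl]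
    simp only [(hsing i).2]
    split_ifs
    · rw [prod_const, Fin.card_Ioi, ← pow_succ]
      congr 1
      omega
    · simp
  rw [hval] at hlim
  refine hlim.congr' ?_
  filter_upwards [eventually_gt_atTop 0] with x hx
  have hx0 : (x : ℂ) ≠ 0 := by exact_mod_cast hx.ne'
  have hz : ∀ i, signedPoint (fun i => (x : ℂ) ^ N i) a i = (x : ℂ) ^ (a i * N i) := by
    intro i
    rw [signedPoint, ← zpow_mul, mul_comm]
  simp only [shiftCoeff, hz]
  congr 1
  · simp only [zpow_add₀ hx0]
  · refine prod_congr rfl fun i _ => ?_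
    rw [mul_comm 2, zpow_mul _ _ 2, zpow_ofNat]

lemma tendsto_laurentEval {n : ℕ} (P : CnAlgebra n) {N ν : Fin n → ℤ}
    (hmax : ∀ κ ∈ P.coeff.support, κ ≠ ν → ∑ i, κ i * N i < ∑ i, ν i * N i) (c : Fin n → ℂ) :
    Tendsto (fun x : ℝ => laurentEval P (fun i => c i * (x : ℂ) ^ N i) *
      (x : ℂ) ^ (-∑ i, ν i * N i)) atTop (𝓝 (P.coeff ν * ∏ i, c i ^ ν i)) := by
  have hlim : Tendsto (fun x : ℝ => ∑ κ ∈ P.coeff.support,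
      P.coeff κ * (∏ i, c i ^ κ i) * (x : ℂ) ^ (∑ i, κ i * N i - ∑ i, ν i * N i)) atTop
      (𝓝 (∑ κ ∈ P.coeff.support, if κ = ν then P.coeff ν * ∏ i, c i ^ ν i else 0)) := by
    refine tendsto_finsetSum _ fun κ hκ => ?_
    split_ifs with h
    · subst h
      simp
    · simpa using (tendsto_ofReal_zpow_zero (sub_neg.2 (hmax κ hκ h))).const_mul
        (P.coeff κ * ∏ i, c i ^ κ i)
  have hval : (∑ κ ∈ P.coeff.support, if κ = ν then P.coeff ν * ∏ i, c i ^ ν i else 0) =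
      P.coeff ν * ∏ i, c i ^ ν i := by
    rw [sum_ite_eq']
    split_ifs with h
    · rfl
    · rw [Finsupp.notMem_support_iff.1 h, zero_mul]
  rw [hval] at hlim
  refine hlim.congr' ?_
  filter_upwards [eventually_gt_atTop 0] with x hx
  have hx0 : (x : ℂ) ≠ 0 := by exact_mod_cast hx.ne'
  rw [laurentEval, Finsupp.sum, sum_mul]
  refine sum_congr rfl fun κ _ => ?_
  rw [sub_eq_add_neg, zpow_add₀ hx0, zpow_finset_sum hx0]
  simp only [mul_zpow, prod_mul_distrib, ← zpow_mul, mul_comm (N _)]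
  ring

lemma isRegularPoint_zpow {n : ℕ} {N : Fin n → ℤ} (hN0 : ∀ i, 0 < N i) (hN : StrictAnti N) {x : ℝ}
    (hx : 1 < x) : IsRegularPoint fun i => (x : ℂ) ^ N i := by
  have hx0 : (x : ℂ) ≠ 0 := by exact_mod_cast (one_pos.trans hx).ne'
  have hne : ∀ k : ℤ, k ≠ 0 → (x : ℂ) ^ k ≠ 1 := by
    intro k hk h
    have h : x ^ k = 1 := by exact_mod_cast h
    exact hk ((zpow_eq_one_iff_right₀ (one_pos.trans hx).le hx.ne').1 h)
  refine ⟨fun i => zpow_ne_zero _ hx0, fun i j hij a b => ?_, fun i a => ?_⟩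
  · rw [← zpow_mul, ← zpow_mul, ← zpow_add₀ hx0]
    refine hne _ ?_
    have h1 := hN hij
    have h2 := hN0 j
    rcases Int.units_eq_one_or a with rfl | rfl <;> rcases Int.units_eq_one_or b with rfl | rfl <;>
      simp <;> omega
  · rw [← zpow_mul]
    refine hne _ ?_
    have h2 := hN0 i
    rcases Int.units_eq_one_or a with rfl | rfl <;> simp <;> omega

/-- The operator acts on a leading weight by the eigenvalue of that weight. -/
theorem eigenvalue_eq_of_leading_weight {n : ℕ} {q t : ℝ} (hq0 : 0 < q) {P : CnAlgebra n} {c : ℂ}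
    (hE : ∀ y : Fin n → ℂ, IsRegularPoint y →
      macdonaldOp q t (laurentEval P) y = c * laurentEval P y)
    {N ν : Fin n → ℤ} (hN0 : ∀ i, 0 < N i) (hN : StrictAnti N) (hν : P.coeff ν ≠ 0)
    (hmax : ∀ κ ∈ P.coeff.support, κ ≠ ν → ∑ i, κ i * N i < ∑ i, ν i * N i) :
    (macdonaldEigenvalue q t ν : ℂ) = c := by
  have h1 : Tendsto (fun x : ℝ => c * (laurentEval P (fun i => (x : ℂ) ^ N i) *
      (x : ℂ) ^ (-∑ i, ν i * N i))) atTop (𝓝 (c * P.coeff ν)) := by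
    simpa using (tendsto_laurentEval P hmax fun _ => 1).const_mul c
  have h2 : Tendsto (fun x : ℝ => ∑ a : Fin n → ℤˣ,
      shiftCoeff t (signedPoint (fun i => (x : ℂ) ^ N i) a) *
        (laurentEval P (fun i => ((√q : ℝ) : ℂ) ^ (a i : ℤ) * (x : ℂ) ^ N i) *
          (x : ℂ) ^ (-∑ i, ν i * N i))) atTop
      (𝓝 (∑ a : Fin n → ℤˣ, (∏ i : Fin n, if a i = 1 then (t : ℂ) ^ (n - i : ℕ) else 1) *
        (P.coeff ν * ∏ i, (((√q : ℝ) : ℂ) ^ (a i : ℤ)) ^ ν i))) :=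
    tendsto_finsetSum _ fun a _ => (tendsto_shiftCoeff t hN0 hN a).mul
      (tendsto_laurentEval P hmax fun i => ((√q : ℝ) : ℂ) ^ (a i : ℤ))
  have hsum : (∑ a : Fin n → ℤˣ, (∏ i : Fin n, if a i = 1 then (t : ℂ) ^ (n - i : ℕ) else 1) *
      (P.coeff ν * ∏ i, (((√q : ℝ) : ℂ) ^ (a i : ℤ)) ^ ν i)) =
      macdonaldEigenvalue q t ν * P.coeff ν := by
    -- Each factor of the eigenvalue is a sum over one sign, so expanding the product gives the sum
    -- over `a` of the limits.
    have hprod : (macdonaldEigenvalue q t ν : ℂ) = ∏ i : Fin n, ∑ e : ℤˣ,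
        (if e = 1 then (t : ℂ) ^ (n - i : ℕ) else 1) * (((√q : ℝ) : ℂ) ^ (e : ℤ)) ^ ν i := by
      rw [macdonaldEigenvalue_eq hq0]
      push_cast
      refine prod_congr rfl fun i _ => ?_
      rw [sum_units_int, eigenFactor]
      simp
      ring
    rw [hprod, prod_univ_sum, Fintype.piFinset_univ, sum_mul]
    refine sum_congr rfl fun a _ => ?_
    rw [prod_mul_distrib]
    ring
  rw [hsum] at h2
  have h3 := tendsto_nhds_unique (h2.congr' ?_) h1
  · exact mul_right_cancel₀ hν h3
  · filter_upwards [eventually_gt_atTop 1] with x hx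
    rw [← mul_assoc, ← hE _ (isRegularPoint_zpow hN0 hN hx), macdonaldOp_eq, sum_mul]
    refine sum_congr rfl fun a _ => ?_
    rw [halfShift, mul_assoc]

/-- The highest weight of an invariant Laurent polynomial is dominant. -/
lemma IsWeylInvariant.isPartition_of_max {n : ℕ} {P : CnAlgebra n} (hP : IsWeylInvariant P)
    {N ν : Fin n → ℤ} (hN0 : ∀ i, 0 < N i) (hN : StrictAnti N) (hν : P.coeff ν ≠ 0)
    (hmax : ∀ κ, P.coeff κ ≠ 0 → ∑ i, κ i * N i ≤ ∑ i, ν i * N i) : IsPartition ν := by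
  constructor
  · intro i j hij
    by_contra! hlt
    have hij : i < j := lt_of_le_of_ne hij fun h => by simp [h] at hlt
    -- Swapping an increasing pair would raise the pairing with `N` by `(ν_j - ν_i)(N_i - N_j) > 0`.
    have heq : signedPerm (1, Equiv.swap i j) ν =
        ν + (Pi.single i (ν j - ν i) - Pi.single j (ν j - ν i)) := by
      funext k
      by_cases hki : k = i
      · subst hki
        simp [signedPerm, hij.ne]
      · by_cases hkj : k = j
        · subst hkj
          simp [signedPerm, hki]
        · simp [signedPerm, hki, hkj, Equiv.swap_apply_of_ne_of_ne]
    have h := hmax _ (by rw [hP (1, Equiv.swap i j) ν]; exact hν)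
    rw [heq] at h
    simp only [Pi.add_apply, Pi.sub_apply, add_mul, sub_mul, sum_add_distrib, sum_sub_distrib,
      Pi.single_apply, ite_mul, zero_mul, sum_ite_eq', mem_univ, if_true] at h
    have := mul_pos (sub_pos.2 hlt) (sub_pos.2 (hN hij))
    linarith
  · intro i
    by_contra! hlt
    have heq : signedPerm (Function.update 1 i (-1), 1) ν = ν + Pi.single i (-2 * ν i) := by
      funext k
      by_cases hki : k = i
      · subst hki
        simp [signedPerm]
        ring
      · simp [signedPerm, hki]
    have h := hmax _ (by rw [hP (Function.update 1 i (-1), 1) ν]; exact hν)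
    rw [heq] at h
    simp only [Pi.add_apply, add_mul, sum_add_distrib, Pi.single_apply, ite_mul, zero_mul,
      sum_ite_eq', mem_univ, if_true] at h
    have := mul_pos (neg_pos.2 hlt) (hN0 i)
    linarith

/-- The Macdonald polynomial is unique if its eigenvalue differs from those of all smaller
partitions. -/
theorem IsMacdonaldPolynomial.unique {n : ℕ} {q t : ℝ} (hq0 : 0 < q) {μ : Fin n → ℤ}
    (hμ : ∀ ν : Fin n → ℤ, IsPartition ν → WeightLT ν μ →
      macdonaldEigenvalue q t ν ≠ macdonaldEigenvalue q t μ) {P Q : CnAlgebra n}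
    (hP : IsMacdonaldPolynomial q t μ P) (hQ : IsMacdonaldPolynomial q t μ Q) : P = Q := by
  obtain ⟨⟨a, ha, hPa⟩, hEP⟩ := hP
  obtain ⟨⟨b, hb, hQb⟩, hEQ⟩ := hQ
  have hd : ∀ ν ∈ (a - b).support, IsPartition ν ∧ WeightLT ν μ := by
    intro ν hν
    rcases mem_union.1 (Finsupp.support_sub hν) with h | h
    · exact ha ν h
    · exact hb ν h
  have hR : P - Q = (a - b).sum fun ν c => c • orbitSum ν := by
    rw [hPa, hQb, add_sub_add_left_eq_sub, Finsupp.sum_sub_index fun ν c d => sub_smul _ _ _]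
  have hinv : IsWeylInvariant (P - Q) := hR ▸ isWeylInvariant_sum_orbitSum fun ν hν => (hd ν hν).1
  have hE : ∀ y : Fin n → ℂ, IsRegularPoint y → macdonaldOp q t (laurentEval (P - Q)) y =
      macdonaldEigenvalue q t μ * laurentEval (P - Q) y := by
    intro y hy
    have hsub : ∀ z : Fin n → ℂ, laurentEval (P - Q) z = laurentEval P z - laurentEval Q z :=
      fun z => map_sub (laurentEvalLin z) P Q
    rw [hsub, mul_sub, ← hEP y hy, ← hEQ y hy]
    simp only [macdonaldOp_eq, halfShift, hsub, mul_sub, sum_sub_distrib]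
  by_contra hne
  -- Injectivity of the pairing on the support makes the maximal weight unique, as the limit
  -- argument requires.
  obtain ⟨N, hN0, hN, hinj⟩ := exists_separating_weight (P - Q).coeff.support
  have hne' : (P - Q).coeff.support.Nonempty := by
    rw [Finsupp.support_nonempty_iff, Ne, AddMonoidAlgebra.coeff_eq_zero]
    exact sub_ne_zero.2 hne
  obtain ⟨ν, hν, hmax⟩ := exists_max_image _ (fun κ : Fin n → ℤ => ∑ i, κ i * N i) hne'
  have hν0 := Finsupp.mem_support_iff.1 hν
  have hpart : IsPartition ν := hinv.isPartition_of_max hN0 hN hν0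
    fun κ hκ => hmax κ (Finsupp.mem_support_iff.2 hκ)
  have hc := eigenvalue_eq_of_leading_weight hq0 hE hN0 hN hν0 fun κ hκ hκν =>
    lt_of_le_of_ne (hmax κ hκ) fun h => hκν (hinj hκ hν h)
  refine hμ ν hpart (hd ν ?_).2 (by exact_mod_cast hc)
  -- The leading weight is a partition, so its coefficient in `P - Q` is the value of `a - b` there;
  -- hence it lies strictly below `μ`.
  rw [Finsupp.mem_support_iff,
    ← coeff_sum_orbitSum (fun ν hν => (hd ν hν).1) hpart (mem_weylOrbit.2 ⟨(1, 1), ?_⟩), ← hR]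
  · exact hν0
  · funext i
    simp [signedPerm]

end

theorem mainTheorem2 (n l : ℕ) (hn : 1 ≤ n) (hl : 1 ≤ l) (q t : ℝ) (hq0 : 0 < q) (hq1 : q < 1)
    (ht : 0 < t) (htl : qShifted q t l ≠ 0) :
    IsMacdonaldPolynomial q t (rowPartition n l) (rowFormula n l q t) ∧
    ((t < 1 ∨ ∀ ν : Fin n → ℤ, IsPartition ν → WeightLT ν (rowPartition n l) →
        macdonaldEigenvalue q t ν ≠ macdonaldEigenvalue q t (rowPartition n l)) →
      ∀ P : CnAlgebra n, IsMacdonaldPolynomial q t (rowPartition n l) P →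
        P = rowFormula n l q t) := by
  obtain ⟨n, rfl⟩ : ∃ m, n = m + 1 := ⟨n - 1, by omega⟩
  have hmac := rowFormula_isMacdonaldPolynomial n l hq0 hq1 ht htl
  refine ⟨hmac, fun h P hP => hP.unique hq0 ?_ hmac⟩
  rcases h with h | h
  · exact fun ν hν hlt => (macdonaldEigenvalue_lt hq0 hq1 ht h hν hlt).ne
  · exact h
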